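/- Let $m,n\in\mathbb N$, let $D\subset\mathbb R^m$ be a smoothly bounded domain (a bounded, connected, non-empty open set with $C^\infty$ boundary), and let $\Omega_{ij}\in L^2(D,\mathbb R^m)$, $1\le i,j\le n$, satisfy $\Omega_{ij}=-\Omega_{ji}$ almost everywhere in $D$. Then there exists $P\in W^{1,2}(D,SO(n))$, that is, $P=(P_{ij})$ with $P_{ij}\in W^{1,2}(D)$ and $P(x)\in SO(n)$ for almost every $x\in D$, such that, writing $$\Omega^P:=P^T\nabla P-P^T\Omega P,\qquad (\Omega^P)_{ij}=\sum_{k}P_{ki}\nabla P_{kj}-\sum_{k,l}P_{ki}\,\Omega_{kl}\,P_{lj}\in\mathbb R^m ,$$ one has $\operatorname{div}\,(\Omega^P)_{ij}=0$ weakly in $D$ for all $1\le i,j\le n$, i.e. $\int_D(\Omega^P)_{ij}\cdot\nabla\varphi\,dx=0$ for every $\varphi\in C_c^\infty(D)$, and $$\|\nabla P\|_{L^2(D)}+\|P^T\nabla P-P^T\Omega P\|_{L^2(D)}\le 3\,\|\Omega\|_{L^2(D)} .$$ Here $\|A\|_{L^2(D)}=\bigl(\int_D\sum_{i,j}|A_{ij}|^2\,dx\bigr)^{1/2}$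 for $A=(A_{ij})$ with entries $A_{ij}\in L^2(D,\mathbb R^m)$ (Hilbert–Schmidt norm). -/

import Mathlib

open MeasureTheory TopologicalSpace
open scoped Distributions ContDiff

/-- `m`-dimensional Euclidean space. -/
abbrev Eucl (m : ℕ) : Type := EuclideanSpace ℝ (Fin m)

/-- A bounded domain (non-empty connected open set) with `C^∞` boundary: near each boundary point,
`D` is the sublevel set `{ρ < 0}` of a smooth local defining function `ρ` with nowhere vanishing
differential. -/
structure IsSmoothlyBoundedDomain {m : ℕ} (D : Opens (Eucl m)) : Prop where
  isConnected : IsConnected (D : Set (Eucl m))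
  isBounded : Bornology.IsBounded (D : Set (Eucl m))
  smooth_boundary : ∀ x ∈ frontier (D : Set (Eucl m)),
    ∃ (U : Opens (Eucl m)) (ρ : Eucl m → ℝ), x ∈ U ∧ ContDiffOn ℝ ∞ ρ U ∧
      (∀ y ∈ U, fderiv ℝ ρ y ≠ 0) ∧ (∀ y ∈ U, y ∈ D ↔ ρ y < 0)

/-- `u ∈ W^{1,2}(D)` with weak gradient `G`: both `u` and `G` are square integrable on `D`, and
`∫_D u ∂ᵢφ = -∫_D Gᵢ φ` for all `φ ∈ C_c^∞(D)` and all `i`. -/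
structure IsW12WithGradient {m : ℕ} (D : Opens (Eucl m)) (u : Eucl m → ℝ)
    (G : Eucl m → Eucl m) : Prop where
  memLp : MemLp u 2 (volume.restrict (D : Set (Eucl m)))
  memLp_gradient : MemLp G 2 (volume.restrict (D : Set (Eucl m)))
  integral_eq : ∀ (φ : 𝓓(D, ℝ)) (i : Fin m),
    ∫ x in (D : Set (Eucl m)), u x * fderiv ℝ φ x (EuclideanSpace.single i 1) =
      -∫ x in (D : Set (Eucl m)), G x i * φ x

/-- `P ∈ W^{1,2}(D, SO(n))` with weak gradient `dP`: each entry `P_{ij}` is in `W^{1,2}(D)` with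
weak gradient `dP_{ij}`, and `P(x) ∈ SO(n)` for almost every `x ∈ D`. -/
structure IsW12SOWithGradient {m n : ℕ} (D : Opens (Eucl m))
    (P : Eucl m → Matrix (Fin n) (Fin n) ℝ)
    (dP : Eucl m → Matrix (Fin n) (Fin n) (Eucl m)) : Prop where
  entry : ∀ i j, IsW12WithGradient D (fun x => P x i j) (fun x => dP x i j)
  mem_SO : ∀ᵐ x ∂(volume.restrict (D : Set (Eucl m))),
    P x ∈ Matrix.specialOrthogonalGroup (Fin n) ℝ

/-- `div F = 0` weakly in `D`: `F` is locally integrable on `D` and `∫_D F · ∇φ = 0` for all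
`φ ∈ C_c^∞(D)`. -/
structure IsWeaklyDivFree {m : ℕ} (D : Opens (Eucl m)) (F : Eucl m → Eucl m) : Prop where
  locallyIntegrableOn : LocallyIntegrableOn F (D : Set (Eucl m)) volume
  integral_eq_zero : ∀ φ : 𝓓(D, ℝ),
    ∫ x in (D : Set (Eucl m)), inner ℝ (F x) (gradient φ x) = 0

/-- The gauge transformed form `Pᵀ∇P - PᵀΩP`, a matrix with entries in `ℝ^m`:
its `(i,j)` entry is `∑ₖ P_{ki} ∇P_{kj} - ∑ₖ ∑ₗ P_{ki} P_{lj} Ω_{kl}`. -/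
noncomputable def gaugeTransform {m n : ℕ} (P : Eucl m → Matrix (Fin n) (Fin n) ℝ)
    (dP Ω : Eucl m → Matrix (Fin n) (Fin n) (Eucl m)) :
    Eucl m → Matrix (Fin n) (Fin n) (Eucl m) :=
  fun x i j => ∑ k, P x k i • dP x k j - ∑ k, ∑ l, (P x k i * P x l j) • Ω x k l

/-- The Hilbert-Schmidt norm of a matrix with entries in `ℝ^m`. -/
noncomputable def hsNorm {m n : ℕ} (A : Matrix (Fin n) (Fin n) (Eucl m)) : ℝ :=
  √(∑ i, ∑ j, ‖A i j‖ ^ 2)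

/-- The norm `‖A‖_{L²(D)}` (with values in `[0, ∞]`), taken with respect to the Hilbert-Schmidt
norm. -/
noncomputable def l2Norm {m n : ℕ} (D : Opens (Eucl m))
    (A : Eucl m → Matrix (Fin n) (Fin n) (Eucl m)) : ENNReal :=
  eLpNorm (fun x => hsNorm (A x)) 2 (volume.restrict (D : Set (Eucl m)))

/-! The gauge is found by minimising the energy `∫ |∇P - ΩP|²` over frames `P ∈ W^{1,2}(D, SO(n))`,
restricted to those for which `Pᵀ∇P` is skew (`IsSkewFrame`). Skewness should follow from `PᵀP = 1`
by a Sobolev product rule; taking it as a constraint is cheaper, since it holds for the constant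
frame, survives the limits used here and is kept by the variations below.

Existence of a minimiser (`exists_isSkewFrame_forall_gaugeEnergy_le`) is the direct method. The
entries of `P` are bounded by `1`, so bounded energy bounds `∇P` in `L²`, and a subsequence
converges weakly. Strong convergence of `P` comes from an interior Rellich argument
(`tendsto_integral_cutoff_mul_sq`): a function differs from its averages over `ε`-balls by `O(ε
‖∇P‖)` in `L²`, while these averages converge pointwise by weak convergence. No mass is lost near
the boundary, because `|P| ≤ 1` (`tendsto_integral_sub_sq`). The limit is thus `SO(n)`-valued almost
everywhere, and the energy is lower semicontinuous.

For the Euler-Lagrange equation, vary `P` to `P exp(εφ α)` with `α = E_ij - E_ji` and `φ` a test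
function. The energy is then exactly quadratic in `ε` (`gaugeEnergy_rotate`), and its linear
coefficient is `4 ∫ (Ω^P)_ij · ∇φ`, because `Ω^P` is skew. Minimality makes this coefficient vanish.

For the bound, compare with the frame `1`: `‖∇P - ΩP‖ ≤ ‖Ω‖`. Orthogonality of `P` gives `|Ω^P| =
|∇P - ΩP|` and `|ΩP| = |Ω|` pointwise, whence `‖∇P‖ ≤ 2‖Ω‖` and the constant `3 = 2 + 1`. -/

open Filter Topology

/-! ### The Cauchy-Schwarz inequality for `L²` functions -/

section CauchySchwarz

variable {α : Type*} [MeasurableSpace α] {μ : Measure α}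

theorem integral_sq_eq_norm_toLp_sq {f : α → ℝ} (hf : MemLp f 2 μ) :
    ∫ x, f x ^ 2 ∂μ = ‖hf.toLp f‖ ^ 2 := by
  rw [← real_inner_self_eq_norm_sq, L2.inner_def]
  refine integral_congr_ae ?_
  filter_upwards [hf.coeFn_toLp] with x hx
  simp [hx, sq]

theorem inner_toLp_eq_integral_mul {f g : α → ℝ} (hf : MemLp f 2 μ) (hg : MemLp g 2 μ) :
    inner ℝ (hf.toLp f) (hg.toLp g) = ∫ x, f x * g x ∂μ := by
  rw [L2.inner_def]
  refine integral_congr_ae ?_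
  filter_upwards [hf.coeFn_toLp, hg.coeFn_toLp] with x hx hy
  simp [hx, hy, mul_comm]

theorem norm_toLp_eq_sqrt {f : α → ℝ} (hf : MemLp f 2 μ) :
    ‖hf.toLp f‖ = √(∫ x, f x ^ 2 ∂μ) := by
  rw [integral_sq_eq_norm_toLp_sq hf, Real.sqrt_sq (norm_nonneg _)]

theorem abs_integral_mul_le_sqrt_mul_sqrt {f g : α → ℝ} (hf : MemLp f 2 μ) (hg : MemLp g 2 μ) :
    |∫ x, f x * g x ∂μ| ≤ √(∫ x, f x ^ 2 ∂μ) * √(∫ x, g x ^ 2 ∂μ) := by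
  rw [← inner_toLp_eq_integral_mul hf hg, ← norm_toLp_eq_sqrt hf, ← norm_toLp_eq_sqrt hg]
  exact abs_real_inner_le_norm _ _

theorem integrable_fun_mul {f g : α → ℝ} (hf : MemLp f 2 μ) (hg : MemLp g 2 μ) :
    Integrable (fun x => f x * g x) μ :=
  hf.integrable_mul hg

end CauchySchwarz

/-! ### Translations and weak gradients -/

section Translation

variable {m : ℕ} {D : Opens (Eucl m)} {u : Eucl m → ℝ} {G : Eucl m → Eucl m}

theorem isFiniteMeasure_restrict_of_isBounded {s : Set (Eucl m)} (hs : Bornology.IsBounded s) :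
    IsFiniteMeasure (volume.restrict s) :=
  ⟨by simpa using hs.measure_lt_top⟩

theorem TestFunction.contDiff_fderiv_apply (φ : 𝓓(D, ℝ)) (y : Eucl m) :
    ContDiff ℝ ∞ fun x => fderiv ℝ φ x y :=
  (φ.contDiff.fderiv_right (m := ∞) (by simp)).clm_apply contDiff_const

theorem TestFunction.memLp (φ : 𝓓(D, ℝ)) (p : ENNReal) (μ : Measure (Eucl m))
    [IsFiniteMeasureOnCompacts μ] : MemLp φ p μ :=
  φ.continuous.memLp_of_hasCompactSupport φ.hasCompactSupport

theorem TestFunction.memLp_fderiv (φ : 𝓓(D, ℝ)) (y : Eucl m) (p : ENNReal)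
    (μ : Measure (Eucl m)) [IsFiniteMeasureOnCompacts μ] :
    MemLp (fun x => fderiv ℝ φ x y) p μ :=
  (φ.contDiff_fderiv_apply y).continuous.memLp_of_hasCompactSupport
    (φ.hasCompactSupport.fderiv_apply ℝ y)

theorem Eucl.sum_smul_single (y : Eucl m) : ∑ i, y i • EuclideanSpace.single i (1 : ℝ) = y := by
  ext j
  simp [Pi.single_apply]

theorem IsW12WithGradient.integral_mul_fderiv (h : IsW12WithGradient D u G) (φ : 𝓓(D, ℝ))
    (y : Eucl m) :
    ∫ x in (D : Set (Eucl m)), u x * fderiv ℝ φ x y =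
      -∫ x in (D : Set (Eucl m)), inner ℝ (G x) y * φ x := by
  have h1 : ∀ x, u x * fderiv ℝ φ x y =
      ∑ i, y i * (u x * fderiv ℝ φ x (EuclideanSpace.single i 1)) := by
    intro x
    conv_lhs => rw [← Eucl.sum_smul_single y]
    rw [map_sum, Finset.mul_sum]
    refine Finset.sum_congr rfl fun i _ => ?_
    rw [map_smul, smul_eq_mul]; ring
  have h2 : ∀ x, inner ℝ (G x) y * φ x = ∑ i, y i * (G x i * φ x) := by
    intro x
    rw [PiLp.inner_apply, Finset.sum_mul]
    refine Finset.sum_congr rfl fun i _ => ?_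
    simp; ring
  simp_rw [h1, h2]
  rw [integral_finsetSum, integral_finsetSum, ← Finset.sum_neg_distrib]
  · refine Finset.sum_congr rfl fun i _ => ?_
    rw [integral_const_mul, integral_const_mul, h.integral_eq]; ring
  · intro i _
    have hG : MemLp (fun x => G x i) 2 (volume.restrict (D : Set (Eucl m))) :=
      h.memLp_gradient.eval_piLp i
    exact (hG.integrable_mul (φ.memLp 2 _)).const_mul _
  · intro i _
    exact (h.memLp.integrable_mul (φ.memLp_fderiv _ 2 _)).const_mul _

/-- The norm of `φ` on the right is taken over the whole space so that it does not change when `φ`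
is translated. -/
theorem IsW12WithGradient.abs_integral_mul_fderiv_le (h : IsW12WithGradient D u G) (φ : 𝓓(D, ℝ))
    (y : Eucl m) :
    |∫ x in (D : Set (Eucl m)), u x * fderiv ℝ φ x y| ≤
      ‖y‖ * √(∫ x in (D : Set (Eucl m)), ‖G x‖ ^ 2) * √(∫ x, φ x ^ 2) := by
  rw [h.integral_mul_fderiv, abs_neg]
  have hGy : MemLp (fun x => inner ℝ (G x) y) 2 (volume.restrict (D : Set (Eucl m))) :=
    h.memLp_gradient.inner_const y
  refine (abs_integral_mul_le_sqrt_mul_sqrt hGy (φ.memLp 2 _)).trans ?_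
  gcongr
  · rw [← Real.sqrt_sq (norm_nonneg y), ← Real.sqrt_mul (sq_nonneg _), ← integral_const_mul]
    refine Real.sqrt_le_sqrt (integral_mono hGy.integrable_sq
      (h.memLp_gradient.integrable_norm_pow (by simp) |>.const_mul _) fun x => ?_)
    have := abs_real_inner_le_norm (G x) y
    calc inner ℝ (G x) y ^ 2 = |inner ℝ (G x) y| ^ 2 := (sq_abs _).symm
      _ ≤ (‖G x‖ * ‖y‖) ^ 2 := by gcongr
      _ = _ := by ring
  · exact Filter.Eventually.of_forall fun x => sq_nonneg _
  · exact (φ.memLp 2 volume).integrable_sq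
  · exact Measure.restrict_le_self

/-- The translate `x ↦ φ (x - z)` of a smooth compactly supported function whose support stays
in `D`. -/
def TestFunction.translate {φ : Eucl m → ℝ} (hφ : ContDiff ℝ ∞ φ) (hc : HasCompactSupport φ)
    (z : Eucl m) (hz : ∀ x ∈ tsupport φ, x + z ∈ D) : 𝓓(D, ℝ) where
  toFun x := φ (x - z)
  contDiff' := hφ.comp (contDiff_id.sub contDiff_const)
  hasCompactSupport' := by
    simpa [Function.comp_def, sub_eq_add_neg] using hc.comp_homeomorph (Homeomorph.addRight (-z))
  tsupport_subset' := by
    intro x hx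
    have h1 : x - z ∈ tsupport φ := by
      have := tsupport_comp_subset_preimage φ (f := fun x : Eucl m => x - z) (by fun_prop)
      exact this hx
    simpa using hz _ h1

/-- Differentiate `t ↦ ∫ u φ(· - ty)`: every translate along the segment is a test function in `D`,
so the weak gradient bounds the derivative, and the mean value inequality on `[0, 1]` concludes. -/
theorem IsW12WithGradient.abs_integral_mul_sub_translate_le
    (hD : Bornology.IsBounded (D : Set (Eucl m))) (h : IsW12WithGradient D u G)
    {φ : Eucl m → ℝ} (hφ : ContDiff ℝ ∞ φ) (hc : HasCompactSupport φ) (y : Eucl m)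
    (hy : ∀ x ∈ tsupport φ, ∀ t ∈ Set.Icc (0 : ℝ) 1, x + t • y ∈ D) :
    |∫ x in (D : Set (Eucl m)), u x * (φ (x - y) - φ x)| ≤
      ‖y‖ * √(∫ x in (D : Set (Eucl m)), ‖G x‖ ^ 2) * √(∫ x, φ x ^ 2) := by
  have := isFiniteMeasure_restrict_of_isBounded hD
  set μ := volume.restrict (D : Set (Eucl m))
  have hu : Integrable u μ := h.memLp.integrable (by norm_num)
  have hfc : Continuous fun x => fderiv ℝ φ x y :=
    ((hφ.fderiv_right (m := ∞) (by simp)).clm_apply contDiff_const).continuous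
  obtain ⟨C, hC⟩ := hfc.bounded_above_of_compact_support (hc.fderiv_apply ℝ y)
  obtain ⟨C', hC'⟩ := hφ.continuous.bounded_above_of_compact_support hc
  have hint : ∀ z : Eucl m, Integrable (fun x => u x * φ (x - z)) μ := fun z =>
    hu.mul_bdd (c := C')
      (hφ.continuous.comp (continuous_id.sub continuous_const)).aestronglyMeasurable
      (Filter.Eventually.of_forall fun x => hC' _)
  let F : ℝ → ℝ := fun t => ∫ x, u x * φ (x - t • y) ∂μ
  let F' : ℝ → ℝ := fun t => ∫ x, u x * -(fderiv ℝ φ (x - t • y) y) ∂μ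
  have hF : ∀ t, HasDerivAt F (F' t) t := by
    intro t
    refine (hasDerivAt_integral_of_dominated_loc_of_deriv_le (s := Set.univ)
      (F := fun t x => u x * φ (x - t • y)) (F' := fun t x => u x * -(fderiv ℝ φ (x - t • y) y))
      (bound := fun x => ‖u x‖ * C) Filter.univ_mem
      (Filter.Eventually.of_forall fun s => (hint _).aestronglyMeasurable) (hint _)
      ?_ ?_ (hu.norm.mul_const _) ?_).2
    · exact hu.aestronglyMeasurable.mul
        (hfc.comp (continuous_id.sub continuous_const)).neg.aestronglyMeasurable
    · refine Filter.Eventually.of_forall fun x s _ => ?_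
      rw [norm_mul, norm_neg]
      gcongr
      exact hC _
    · refine Filter.Eventually.of_forall fun x s _ => ?_
      have hd : HasDerivAt (fun s : ℝ => x - s • y) (-y) s := by
        simpa using ((hasDerivAt_id s).smul_const y).const_sub x
      have := ((hφ.differentiable (by simp)).differentiableAt (x := x - s • y)).hasFDerivAt.comp_hasDerivAt
        s hd
      simpa using this.const_mul (u x)
  have hbound : ∀ t ∈ Set.Ico (0 : ℝ) 1, ‖F' t‖ ≤
      ‖y‖ * √(∫ x, ‖G x‖ ^ 2 ∂μ) * √(∫ x, φ x ^ 2) := by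
    intro t ht
    have ht' := Set.Ico_subset_Icc_self ht
    let ψ : 𝓓(D, ℝ) := TestFunction.translate hφ hc (t • y) (fun x hx => hy x hx t ht')
    have hψ : ∀ x, fderiv ℝ ψ x y = fderiv ℝ φ (x - t • y) y := by
      intro x
      change fderiv ℝ (fun x => φ (x - t • y)) x y = _
      rw [fderiv_comp_sub]
    have h2 : ∫ x, ψ x ^ 2 = ∫ x, φ x ^ 2 :=
      integral_sub_right_eq_self (fun x => φ x ^ 2) (t • y)
    have := h.abs_integral_mul_fderiv_le ψ y
    rw [h2] at this
    simp_rw [hψ] at this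
    simpa [F', integral_neg, μ] using this
  have key := norm_image_sub_le_of_norm_deriv_le_segment_01' (f := F)
    (fun t _ => (hF t).hasDerivWithinAt) hbound
  have hFF : F 1 - F 0 = ∫ x, u x * (φ (x - y) - φ x) ∂μ := by
    simp only [F]
    rw [← integral_sub (hint _) (hint _)]
    simp [mul_sub]
  rwa [hFF] at key

/-- Duality form of the estimate of difference quotients by the weak gradient: localised by a
cut-off `χ`, a translation by `y` changes `u` by at most `‖y‖ ‖G‖` in `L²`. -/
theorem IsW12WithGradient.abs_integral_translate_sub_le
    (hD : Bornology.IsBounded (D : Set (Eucl m))) (h : IsW12WithGradient D u G)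
    (χ : 𝓓(D, ℝ)) (hχ : ∀ x, |χ x| ≤ 1) (y : Eucl m)
    (hy : ∀ x ∈ tsupport χ, ∀ t ∈ Set.Icc (0 : ℝ) 1, x + t • y ∈ D)
    {v : Eucl m → ℝ} (hv : MemLp v 2 volume) :
    |∫ x, v x * (χ x * ((D : Set (Eucl m)).indicator u (x + y) -
        (D : Set (Eucl m)).indicator u x))| ≤
      ‖y‖ * √(∫ x in (D : Set (Eucl m)), ‖G x‖ ^ 2) * √(∫ x, v x ^ 2) := by
  set W := (D : Set (Eucl m)).indicator u with hW
  set A := √(∫ x in (D : Set (Eucl m)), ‖G x‖ ^ 2)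
  have hWm : MemLp W 2 volume := (memLp_indicator_iff_restrict D.isOpen.measurableSet).2 h.memLp
  have hWy : MemLp (fun x => W (x + y)) 2 volume :=
    hWm.comp_measurePreserving (measurePreserving_add_right volume y)
  have hf : MemLp (fun x => χ x * (W (x + y) - W x)) 2 volume :=
    (hWy.sub hWm).mul (χ.memLp ⊤ volume) (r := 2)
  -- Both sides are continuous in `f ∈ L²`, so it suffices to test with smooth compactly supported
  -- `g`; then `gχ` is admissible in the previous estimate.
  have hcl : ∀ f : Lp ℝ 2 (volume : Measure (Eucl m)), |inner ℝ f (hf.toLp _)| ≤ ‖y‖ * A * ‖f‖ := by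
    refine isClosed_property (Lp.dense_hasCompactSupport_contDiff (E := Eucl m) (F := ℝ)
      (μ := volume) (p := 2) (by simp)).denseRange_val (isClosed_le (by fun_prop) (by fun_prop)) ?_
    rintro ⟨f, g, hfg, hgc, hg⟩
    have hgm : MemLp g 2 volume := hg.continuous.memLp_of_hasCompactSupport hgc
    have hf' : f = hgm.toLp g := by
      apply Lp.ext
      exact hfg.trans hgm.coeFn_toLp.symm
    change |inner ℝ f (hf.toLp _)| ≤ ‖y‖ * A * ‖f‖
    rw [hf', inner_toLp_eq_integral_mul, norm_toLp_eq_sqrt]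
    have hgχ : ContDiff ℝ ∞ fun x => g x * χ x := hg.mul χ.contDiff
    have hgχc : HasCompactSupport fun x => g x * χ x := χ.hasCompactSupport.mul_left
    have hts : tsupport (fun x => g x * χ x) ⊆ tsupport χ := tsupport_mul_subset_right
    have hgχm : MemLp (fun x => g x * χ x) 2 volume :=
      hgχ.continuous.memLp_of_hasCompactSupport hgχc
    have key := h.abs_integral_mul_sub_translate_le hD hgχ hgχc y
      (fun x hx t ht => hy x (hts hx) t ht)
    have hgχy : MemLp (fun x => g (x - y) * χ (x - y)) 2 volume :=
      hgχm.comp_measurePreserving (measurePreserving_sub_right volume y)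
    -- A change of variables moves the translation from `W` to the test function.
    have e1 : ∫ x, g x * (χ x * (W (x + y) - W x)) =
        ∫ x in (D : Set (Eucl m)), u x * (g (x - y) * χ (x - y) - g x * χ x) := by
      rw [← integral_indicator D.isOpen.measurableSet]
      have : ((D : Set (Eucl m)).indicator fun x => u x * (g (x - y) * χ (x - y) - g x * χ x)) =
          fun x => W x * (g (x - y) * χ (x - y)) - W x * (g x * χ x) := by
        ext x
        by_cases hx : x ∈ (D : Set (Eucl m)) <;> simp [hW, hx, mul_sub]
      rw [this, integral_sub (integrable_fun_mul hWm hgχy) (integrable_fun_mul hWm hgχm)]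
      have h3 : ∫ x, W x * (g (x - y) * χ (x - y)) = ∫ x, W (x + y) * (g x * χ x) := by
        rw [← integral_add_right_eq_self (fun x => W x * (g (x - y) * χ (x - y))) y]
        simp
      rw [h3, ← integral_sub (integrable_fun_mul hWy hgχm) (integrable_fun_mul hWm hgχm)]
      congr 1; ext x; ring
    rw [e1]
    refine key.trans ?_
    gcongr
    · exact hgχm.integrable_sq
    · exact hgm.integrable_sq
    · intro x
      simp only [mul_pow]
      have : χ x ^ 2 ≤ 1 := by
        rw [← sq_abs]; exact pow_le_one₀ (abs_nonneg _) (hχ x)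
      nlinarith [sq_nonneg (g x)]
  have := hcl (hv.toLp v)
  rwa [inner_toLp_eq_integral_mul, norm_toLp_eq_sqrt] at this

end Translation

/-! ### Interior Rellich compactness by averaging over small balls -/

section Rellich

variable {m : ℕ} {D : Opens (Eucl m)}

/-- The hypothesis of Fubini for averaging over translations: addition pushes the product measure to
a multiple of `volume`, so the translated factor is in `L²` of the product over a finite measure in
`y`. -/
theorem integrable_prod_mul_translate {v W : Eucl m → ℝ} (hv : MemLp v 2 volume)
    (hW : MemLp W 2 volume) (B : Set (Eucl m)) [IsFiniteMeasure (volume.restrict B)] :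
    Integrable (Function.uncurry fun y x => v x * W (x + y))
      ((volume.restrict B).prod volume) := by
  have h1 : MemLp (fun z : Eucl m × Eucl m => v z.2) 2 ((volume.restrict B).prod volume) :=
    hv.comp_snd _
  have h2 : MemLp (fun z : Eucl m × Eucl m => W (z.1 + z.2)) 2
      ((volume.restrict B).prod volume) :=
    (hW.comp_snd (volume.restrict B)).comp_measurePreserving
      (measurePreserving_prod_add (volume.restrict B) volume)
  refine (integrable_fun_mul h1 h2).congr (Eventually.of_forall fun z => ?_)
  simp [Function.uncurry, add_comm]

theorem sq_setIntegral_le {α : Type*} [MeasurableSpace α] {μ : Measure α} {B : Set α}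
    (hB : μ B ≠ ⊤) {f : α → ℝ} (hf : MemLp f 2 μ) :
    (∫ y in B, f y ∂μ) ^ 2 ≤ μ.real B * ∫ y, f y ^ 2 ∂μ := by
  have : IsFiniteMeasure (μ.restrict B) := ⟨by simpa using hB.lt_top⟩
  have h := abs_integral_mul_le_sqrt_mul_sqrt (μ := μ.restrict B) (f := fun _ => (1 : ℝ)) (g := f)
    (memLp_const _) (hf.mono_measure Measure.restrict_le_self)
  simp only [one_mul, one_pow, integral_const, smul_eq_mul, mul_one] at h
  have h0 : (0 : ℝ) ≤ ∫ y in B, f y ^ 2 ∂μ := integral_nonneg fun _ => sq_nonneg _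
  calc (∫ y in B, f y ∂μ) ^ 2 = |∫ y in B, f y ∂μ| ^ 2 := (sq_abs _).symm
    _ ≤ (√((μ.restrict B).real Set.univ) * √(∫ y in B, f y ^ 2 ∂μ)) ^ 2 := by gcongr
    _ = μ.real B * ∫ y in B, f y ^ 2 ∂μ := by
      rw [mul_pow, Real.sq_sqrt measureReal_nonneg, Real.sq_sqrt h0]; simp
    _ ≤ _ := by
      gcongr
      · exact Eventually.of_forall fun _ => sq_nonneg _
      · exact hf.integrable_sq
      · exact Measure.restrict_le_self

/-- Averages over balls of a weakly null bounded sequence tend to zero strongly, locally. -/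
theorem tendsto_integral_mul_setIntegral_translate {W : ℕ → Eucl m → ℝ}
    (hW : ∀ k, MemLp (W k) 2 volume) {C : ℝ} (hC : ∀ k, ∫ x, W k x ^ 2 ≤ C)
    (hw : ∀ S, MeasurableSet S → volume S ≠ ⊤ →
      Tendsto (fun k => ∫ x in S, W k x) atTop (𝓝 0))
    {χ : Eucl m → ℝ} (hχ : Continuous χ) (hχc : HasCompactSupport χ) (ε : ℝ) :
    Tendsto (fun k => ∫ x, W k x * χ x * ∫ y in Metric.ball 0 ε, W k (x + y)) atTop (𝓝 0) := by
  set B := Metric.ball (0 : Eucl m) ε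
  have hB : IsFiniteMeasure (volume.restrict B) :=
    isFiniteMeasure_restrict_of_isBounded Metric.isBounded_ball
  have hBf : ∀ x : Eucl m, volume (Metric.ball x ε) ≠ ⊤ := fun x => measure_ball_lt_top.ne
  let a : ℕ → Eucl m → ℝ := fun k x => ∫ y in B, W k (x + y)
  have hWy : ∀ k x, MemLp (fun y => W k (x + y)) 2 volume := fun k x =>
    (hW k).comp_measurePreserving (measurePreserving_add_left volume x)
  have ha_eq : ∀ k x, a k x = ∫ y in Metric.ball x ε, W k y := by
    intro k x
    have h := (measurePreserving_add_left volume x).setIntegral_preimage_emb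
      (measurableEmbedding_addLeft x) (W k) (Metric.ball x ε)
    simpa [B, a] using h
  have ha_lim : ∀ x, Tendsto (fun k => a k x) atTop (𝓝 0) := by
    intro x
    simp_rw [ha_eq]
    exact hw _ measurableSet_ball (hBf x)
  have ha_bd : ∀ k x, a k x ^ 2 ≤ volume.real B * C := by
    intro k x
    refine (sq_setIntegral_le (hBf 0) (hWy k x)).trans ?_
    have : ∫ y, W k (x + y) ^ 2 = ∫ y, W k y ^ 2 :=
      integral_add_left_eq_self (fun y => W k y ^ 2) x
    rw [this]
    gcongr
    exact hC k
  have ha_meas : ∀ k, AEStronglyMeasurable (a k) volume := by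
    intro k
    have h2 : MemLp (fun z : Eucl m × Eucl m => W k (z.1 + z.2)) 2
        ((volume.restrict B).prod volume) :=
      ((hW k).comp_snd (volume.restrict B)).comp_measurePreserving
        (measurePreserving_prod_add (volume.restrict B) volume)
    have := h2.aestronglyMeasurable.prod_swap.integral_prod_right'
    simpa [a, add_comm] using this
  have hχa : ∀ k, MemLp (fun x => χ x * a k x) 2 volume := by
    intro k
    refine (hχ.memLp_of_hasCompactSupport hχc (p := 2)).mul (p := ⊤) (q := 2)
      (memLp_top_of_bound (ha_meas k) (√(volume.real B * C)) (Eventually.of_forall fun x => ?_)) |>.congr_norm ?_ ?_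
    · exact Real.abs_le_sqrt (ha_bd k x)
    · exact hχ.aestronglyMeasurable.mul (ha_meas k)
    · exact Eventually.of_forall fun x => by simp [mul_comm]
  -- The ball averages tend to zero pointwise and are bounded uniformly in `k` and `x`; the cut-off
  -- makes the dominating function integrable.
  have hlim : Tendsto (fun k => ∫ x, (χ x * a k x) ^ 2) atTop (𝓝 0) := by
    have : (0 : ℝ) = ∫ x : Eucl m, (0 : ℝ) := by simp
    rw [this]
    refine tendsto_integral_of_dominated_convergence (fun x => χ x ^ 2 * (volume.real B * C))
      (fun k => (hχa k).aestronglyMeasurable.pow 2)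
      ((hχ.memLp_of_hasCompactSupport hχc (p := 2)).integrable_sq.mul_const _) ?_ ?_
    · intro k
      refine Eventually.of_forall fun x => ?_
      rw [Real.norm_of_nonneg (sq_nonneg _), mul_pow]
      gcongr
      exact ha_bd k x
    · refine Eventually.of_forall fun x => ?_
      simpa using ((ha_lim x).const_mul (χ x)).pow 2
  have hsq : Tendsto (fun k => √C * √(∫ x, (χ x * a k x) ^ 2)) atTop (𝓝 0) := by
    simpa using hlim.sqrt.const_mul (√C)
  refine squeeze_zero_norm (fun k => ?_) hsq
  have h := abs_integral_mul_le_sqrt_mul_sqrt (hW k) (hχa k)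
  simp_rw [← mul_assoc] at h
  refine h.trans ?_
  gcongr
  exact hC k

/-- Local form of the Rellich compactness theorem: a weakly null sequence in `W^{1,2}(D)` tends to
zero strongly in `L²`, locally in `D`. -/
theorem tendsto_integral_cutoff_mul_sq (hD : Bornology.IsBounded (D : Set (Eucl m)))
    {w : ℕ → Eucl m → ℝ} {G : ℕ → Eucl m → Eucl m} (h : ∀ k, IsW12WithGradient D (w k) (G k))
    {M C : ℝ} (hM : ∀ k, ∫ x in (D : Set (Eucl m)), ‖G k x‖ ^ 2 ≤ M)
    (hC : ∀ k, ∫ x in (D : Set (Eucl m)), w k x ^ 2 ≤ C)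
    (hw : ∀ S, MeasurableSet S →
      Tendsto (fun k => ∫ x in S, w k x ∂(volume.restrict (D : Set (Eucl m)))) atTop (𝓝 0))
    (χ : 𝓓(D, ℝ)) (hχ : ∀ x, |χ x| ≤ 1) :
    Tendsto (fun k => ∫ x in (D : Set (Eucl m)), χ x * w k x ^ 2) atTop (𝓝 0) := by
  let W : ℕ → Eucl m → ℝ := fun k => (D : Set (Eucl m)).indicator (w k)
  have hW : ∀ k, MemLp (W k) 2 volume := fun k =>
    (memLp_indicator_iff_restrict D.isOpen.measurableSet).2 (h k).memLp
  have hWsq : ∀ k, ∫ x, W k x ^ 2 = ∫ x in (D : Set (Eucl m)), w k x ^ 2 := by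
    intro k
    rw [← integral_indicator D.isOpen.measurableSet]
    congr 1; ext x
    by_cases hx : x ∈ (D : Set (Eucl m)) <;> simp [W, hx]
  have hWχ : ∀ k, ∫ x in (D : Set (Eucl m)), χ x * w k x ^ 2 = ∫ x, W k x * χ x * W k x := by
    intro k
    rw [← integral_indicator D.isOpen.measurableSet]
    congr 1; ext x
    by_cases hx : x ∈ (D : Set (Eucl m)) <;> simp [W, hx]
    ring
  have hWw : ∀ S, MeasurableSet S → volume S ≠ ⊤ →
      Tendsto (fun k => ∫ x in S, W k x) atTop (𝓝 0) := by
    intro S hS _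
    refine (hw S hS).congr fun k => ?_
    rw [integral_indicator D.isOpen.measurableSet, Measure.restrict_restrict hS,
      Measure.restrict_restrict D.isOpen.measurableSet, Set.inter_comm]
  -- Translations shorter than `δ` keep the support of `χ` inside `D`.
  obtain ⟨δ, hδ, hδD⟩ := χ.hasCompactSupport.isCompact.exists_cthickening_subset_open D.isOpen
    χ.tsupport_subset
  simp_rw [hWχ]
  rw [Metric.tendsto_atTop]
  intro η hη
  set N := √M * √C
  have hN : 0 ≤ N := by positivity
  -- The radius `ε` makes the translation error at most `η / 2`; the denominator uses `N + 1`
  -- because `N` may vanish.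
  obtain ⟨ε, hε, hεδ, hεN⟩ : ∃ ε : ℝ, 0 < ε ∧ ε ≤ δ ∧ ε * N ≤ η / 2 := by
    refine ⟨min δ (η / (2 * (N + 1))), by positivity, min_le_left _ _, ?_⟩
    calc min δ (η / (2 * (N + 1))) * N ≤ η / (2 * (N + 1)) * (N + 1) := by
          gcongr
          · exact min_le_right _ _
          · linarith
      _ = η / 2 := by field_simp
  set B := Metric.ball (0 : Eucl m) ε
  have hB : IsFiniteMeasure (volume.restrict B) :=
    isFiniteMeasure_restrict_of_isBounded Metric.isBounded_ball
  have hBpos : 0 < volume.real B :=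
    ENNReal.toReal_pos (Metric.measure_ball_pos _ _ hε).ne' measure_ball_lt_top.ne
  have hb := tendsto_integral_mul_setIntegral_translate hW (fun k => (hWsq k).le.trans (hC k)) hWw
    χ.continuous χ.hasCompactSupport ε
  rw [Metric.tendsto_atTop] at hb
  obtain ⟨K, hK⟩ := hb (volume.real B * (η / 2)) (by positivity)
  refine ⟨K, fun k hk => ?_⟩
  have hbk := hK k hk
  rw [Real.dist_0_eq_abs] at hbk ⊢
  have hv : MemLp (fun x => W k x * χ x) 2 volume := (χ.memLp ⊤ volume).mul (hW k) (r := 2)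
  have hint := integrable_prod_mul_translate hv (hW k) B
  have hWy : ∀ y, MemLp (fun x => W k (x + y)) 2 volume := fun y =>
    (hW k).comp_measurePreserving (measurePreserving_add_right volume y)
  set I := ∫ x, W k x * χ x * W k x
  have hy : ∀ y ∈ B, ‖(∫ x, W k x * χ x * W k (x + y)) - I‖ ≤ ε * N := by
    intro y hy
    have hyε : ‖y‖ < ε := by simpa [B] using hy
    have hyD : ∀ x ∈ tsupport χ, ∀ t ∈ Set.Icc (0 : ℝ) 1, x + t • y ∈ D := by
      intro x hx t ht
      refine hδD (Metric.mem_cthickening_of_dist_le _ x _ _ hx ?_)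
      rw [dist_self_add_left, norm_smul, Real.norm_of_nonneg ht.1]
      calc t * ‖y‖ ≤ 1 * ε := by gcongr; exact ht.2
        _ ≤ δ := by linarith
    have key := (h k).abs_integral_translate_sub_le hD χ hχ y hyD (hW k)
    have e : (∫ x, W k x * χ x * W k (x + y)) - I =
        ∫ x, W k x * (χ x * (W k (x + y) - W k x)) := by
      rw [← integral_sub (integrable_fun_mul hv (hWy y)) (integrable_fun_mul hv (hW k))]
      congr 1; ext x; ring
    rw [e]
    refine key.trans ?_
    rw [mul_assoc]
    simp only [N]
    gcongr
    · exact hM k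
    · exact (hWsq k).le.trans (hC k)
  have hdiff : ‖∫ y in B, ((∫ x, W k x * χ x * W k (x + y)) - I)‖ ≤ ε * N * volume.real B :=
    norm_setIntegral_le_of_norm_le_const measure_ball_lt_top hy
  have hint' : Integrable (fun y => ∫ x, W k x * χ x * W k (x + y)) (volume.restrict B) :=
    hint.integral_prod_left
  -- Averaging over `y ∈ B` and applying Fubini turns the translated integrals into the ball
  -- averages already known to be small.
  rw [integral_sub hint' (integrable_const _), integral_integral_swap hint] at hdiff
  simp only [integral_const_mul, integral_const, smul_eq_mul, measureReal_restrict_apply_univ]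
    at hdiff
  set J := ∫ x, W k x * χ x * ∫ y in B, W k (x + y)
  have h1 : volume.real B * |I| < volume.real B * η := by
    calc volume.real B * |I| = |volume.real B * I| := by rw [abs_mul, abs_of_pos hBpos]
      _ = |J - (J - volume.real B * I)| := by congr 1; ring
      _ ≤ |J| + |J - volume.real B * I| := abs_sub _ _
      _ < volume.real B * (η / 2) + ε * N * volume.real B := by
        exact add_lt_add_of_lt_of_le hbk hdiff
      _ ≤ volume.real B * (η / 2) + η / 2 * volume.real B := by gcongr
      _ = _ := by ring
  exact lt_of_mul_lt_mul_left h1 hBpos.le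

end Rellich

/-! ### Weak sequential compactness in `L²` -/

section WeakCompactness

/-- Sequential Banach-Alaoglu, transported to `H` by the Riesz isometry. -/
theorem exists_subseq_tendsto_inner {H : Type*} [NormedAddCommGroup H] [InnerProductSpace ℝ H]
    [CompleteSpace H] [SeparableSpace H] {x : ℕ → H} {C : ℝ} (hx : ∀ k, ‖x k‖ ≤ C) :
    ∃ (a : H) (φ : ℕ → ℕ), StrictMono φ ∧
      ∀ y : H, Tendsto (fun k => inner ℝ (x (φ k)) y) atTop (𝓝 (inner ℝ a y)) := by
  let T : ℕ → WeakDual ℝ H := fun k => StrongDual.toWeakDual (InnerProductSpace.toDual ℝ H (x k))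
  have hT : ∀ k, T k ∈ WeakDual.toStrongDual ⁻¹' Metric.closedBall (0 : StrongDual ℝ H) C := by
    intro k
    simpa [T] using hx k
  obtain ⟨b, -, φ, hφ, hb⟩ := WeakDual.isSeqCompact_closedBall ℝ H 0 C hT
  refine ⟨(InnerProductSpace.toDual ℝ H).symm (WeakDual.toStrongDual b), φ, hφ, fun y => ?_⟩
  rw [InnerProductSpace.toDual_symm_apply]
  exact ((WeakDual.eval_continuous y).tendsto b).comp hb

/-- The finite family is regarded as one sequence in the Hilbert sum of copies of `L²`, so that a
single subsequence serves all indices. -/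
theorem exists_subseq_tendsto_integral_mul {α ι : Type*} [MeasurableSpace α]
    [MeasurableSpace.CountablyGenerated α] [Fintype ι] {μ : Measure α} [SFinite μ]
    {f : ℕ → ι → α → ℝ} (hf : ∀ k i, MemLp (f k i) 2 μ) {C : ℝ}
    (hC : ∀ k i, ∫ x, f k i x ^ 2 ∂μ ≤ C) :
    ∃ (g : ι → α → ℝ) (φ : ℕ → ℕ), StrictMono φ ∧ (∀ i, MemLp (g i) 2 μ) ∧
      ∀ i v, MemLp v 2 μ →
        Tendsto (fun k => ∫ x, f (φ k) i x * v x ∂μ) atTop (𝓝 (∫ x, g i x * v x ∂μ)) := by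
  classical
  have : Fact ((2 : ENNReal) ≠ ⊤) := ⟨by simp⟩
  let X : ℕ → PiLp 2 (fun _ : ι => Lp ℝ 2 μ) := fun k =>
    WithLp.toLp 2 fun i => (hf k i).toLp (f k i)
  have hX : ∀ k, ‖X k‖ ≤ √(∑ _i : ι, C) := by
    intro k
    rw [PiLp.norm_eq_of_L2]
    refine Real.sqrt_le_sqrt (Finset.sum_le_sum fun i _ => ?_)
    change ‖(hf k i).toLp (f k i)‖ ^ 2 ≤ C
    rw [← integral_sq_eq_norm_toLp_sq]
    exact hC k i
  obtain ⟨a, φ, hφ, ha⟩ := exists_subseq_tendsto_inner hX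
  refine ⟨fun i => a i, φ, hφ, fun i => Lp.memLp _, fun i v hv => ?_⟩
  have h := ha (PiLp.single 2 i (hv.toLp v))
  have e : ∀ b : PiLp 2 (fun _ : ι => Lp ℝ 2 μ),
      inner ℝ b (PiLp.single 2 i (hv.toLp v)) = inner ℝ (b i) (hv.toLp v) := by
    intro b
    rw [PiLp.inner_apply, Finset.sum_eq_single i]
    · simp
    · intro j _ hj; simp [hj]
    · simp
  simp only [e] at h
  have e1 : ∀ k, inner ℝ (X (φ k) i) (hv.toLp v) = ∫ x, f (φ k) i x * v x ∂μ := fun k =>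
    inner_toLp_eq_integral_mul (hf (φ k) i) hv
  have e2 : inner ℝ (a i) (hv.toLp v) = ∫ x, a i x * v x ∂μ := by
    have := inner_toLp_eq_integral_mul (Lp.memLp (a i)) hv
    rwa [Lp.toLp_coeFn] at this
  simpa only [e1, e2] using h

end WeakCompactness

/-! ### From interior to global strong convergence -/

section StrongConvergence

variable {m : ℕ} {D : Opens (Eucl m)}

theorem TestFunction.exists_eq_one_of_isCompact {K : Set (Eucl m)} (hK : IsCompact K)
    (hKD : K ⊆ D) : ∃ χ : 𝓓(D, ℝ), (∀ x, χ x ∈ Set.Icc (0 : ℝ) 1) ∧ ∀ x ∈ K, χ x = 1 := by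
  obtain ⟨K', hK', hKK', hK'D⟩ := exists_compact_between hK D.isOpen hKD
  obtain ⟨f, hf1, hf0, hf⟩ := exists_contMDiffMap_one_nhds_of_subset_interior
    (n := (⊤ : ℕ∞)) (modelWithCornersSelf ℝ (Eucl m)) hK.isClosed hKK'
  have hts : tsupport f ⊆ K' :=
    closure_minimal (fun x hx => by_contra fun h => hx (hf0 x h)) hK'.isClosed
  refine ⟨⟨f, f.contMDiff.contDiff, hK'.of_isClosed_subset (isClosed_tsupport _) hts,
    hts.trans hK'D⟩, hf, fun x hx => ?_⟩
  exact hf1.self_of_nhdsSet x hx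

theorem exists_isCompact_integral_sub_lt (hD : Bornology.IsBounded (D : Set (Eucl m)))
    {f : Eucl m → ℝ} (hf : IntegrableOn f D) {η : ℝ} (hη : 0 < η) :
    ∃ K : Set (Eucl m), IsCompact K ∧ K ⊆ D ∧
      (∫ x in (D : Set (Eucl m)), f x) - ∫ x in K, f x < η := by
  obtain ⟨F, hFc, hFD, hFU, hFm⟩ := D.isOpen.exists_iUnion_isClosed
  have h : Tendsto (fun k => ∫ x in F k, f x) atTop (𝓝 (∫ x in ⋃ k, F k, f x)) :=
    tendsto_setIntegral_of_monotone (fun k => (hFc k).measurableSet) hFm (by rwa [hFU])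
  rw [hFU] at h
  obtain ⟨k, hk⟩ := (h.eventually_const_lt (sub_lt_self _ hη)).exists
  exact ⟨F k, Metric.isCompact_of_isClosed_isBounded (hFc k) (hD.subset (hFD k)), hFD k,
    by linarith⟩

theorem IsW12WithGradient.sub {u v : Eucl m → ℝ} {G H : Eucl m → Eucl m}
    (hu : IsW12WithGradient D u G) (hv : IsW12WithGradient D v H) :
    IsW12WithGradient D (fun x => u x - v x) (fun x => G x - H x) where
  memLp := hu.memLp.sub hv.memLp
  memLp_gradient := hu.memLp_gradient.sub hv.memLp_gradient
  integral_eq φ i := by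
    have h1 := hu.integral_eq φ i
    have h2 := hv.integral_eq φ i
    simp only [sub_mul, PiLp.sub_apply]
    rw [integral_sub, integral_sub, h1, h2]
    · ring
    · exact integrable_fun_mul (hu.memLp_gradient.eval_piLp i) (φ.memLp 2 _)
    · exact integrable_fun_mul (hv.memLp_gradient.eval_piLp i) (φ.memLp 2 _)
    · exact integrable_fun_mul hu.memLp (φ.memLp_fderiv _ 2 _)
    · exact integrable_fun_mul hv.memLp (φ.memLp_fderiv _ 2 _)

theorem integral_norm_sub_sq_le {α E : Type*} [MeasurableSpace α] {μ : Measure α}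
    [NormedAddCommGroup E] {f g : α → E} (hf : MemLp f 2 μ) (hg : MemLp g 2 μ) :
    ∫ x, ‖f x - g x‖ ^ 2 ∂μ ≤ 2 * ∫ x, ‖f x‖ ^ 2 ∂μ + 2 * ∫ x, ‖g x‖ ^ 2 ∂μ := by
  have hf2 := hf.integrable_norm_pow (by simp)
  have hg2 := hg.integrable_norm_pow (by simp)
  have hfg2 := (hf.sub hg).integrable_norm_pow (by simp)
  rw [← integral_const_mul, ← integral_const_mul, ← integral_add (hf2.const_mul _) (hg2.const_mul _)]
  refine integral_mono hfg2 ((hf2.const_mul _).add (hg2.const_mul _)) fun x => ?_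
  have h := norm_sub_le (f x) (g x)
  calc ‖f x - g x‖ ^ 2 ≤ (‖f x‖ + ‖g x‖) ^ 2 := by gcongr
    _ ≤ 2 * ‖f x‖ ^ 2 + 2 * ‖g x‖ ^ 2 := by nlinarith [sq_nonneg (‖f x‖ - ‖g x‖)]

/-- Rellich compactness on all of `D`, without boundary regularity, for uniformly bounded
sequences. -/
theorem tendsto_integral_sub_sq (hD : Bornology.IsBounded (D : Set (Eucl m)))
    {u : ℕ → Eucl m → ℝ} {G : ℕ → Eucl m → Eucl m} (hu : ∀ k, IsW12WithGradient D (u k) (G k))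
    {v : Eucl m → ℝ} {H : Eucl m → Eucl m} (hv : IsW12WithGradient D v H)
    (hb : ∀ k, ∀ᵐ x ∂(volume.restrict (D : Set (Eucl m))), |u k x| ≤ 1)
    {M : ℝ} (hM : ∀ k, ∫ x in (D : Set (Eucl m)), ‖G k x‖ ^ 2 ≤ M)
    (hw : ∀ S, MeasurableSet S →
      Tendsto (fun k => ∫ x in S, u k x ∂(volume.restrict (D : Set (Eucl m)))) atTop
        (𝓝 (∫ x in S, v x ∂(volume.restrict (D : Set (Eucl m)))))) :
    Tendsto (fun k => ∫ x in (D : Set (Eucl m)), (u k x - v x) ^ 2) atTop (𝓝 0) := by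
  have := isFiniteMeasure_restrict_of_isBounded hD
  set μ := volume.restrict (D : Set (Eucl m)) with hμ
  have hvsq : Integrable (fun x => v x ^ 2) μ := hv.memLp.integrable_sq
  have husub : ∀ k, IsW12WithGradient D (fun x => u k x - v x) (fun x => G k x - H x) :=
    fun k => (hu k).sub hv
  have hsq : ∀ k, Integrable (fun x => (u k x - v x) ^ 2) μ := fun k =>
    (husub k).memLp.integrable_sq
  -- An integrable majorant of `(u_k - v)²` independent of `k`, available because `|u_k| ≤ 1`; it
  -- controls the mass near the boundary.
  let f : Eucl m → ℝ := fun x => 2 + 2 * v x ^ 2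
  have hf : Integrable f μ := (integrable_const _).add (hvsq.const_mul 2)
  have hsqf : ∀ k, ∀ᵐ x ∂μ, (u k x - v x) ^ 2 ≤ f x := by
    intro k
    filter_upwards [hb k] with x hx
    have : u k x ^ 2 ≤ 1 := by
      rw [← sq_abs]; exact pow_le_one₀ (abs_nonneg _) hx
    simp only [f]
    nlinarith [sq_nonneg (u k x + v x)]
  have hloc : ∀ χ : 𝓓(D, ℝ), (∀ x, |χ x| ≤ 1) →
      Tendsto (fun k => ∫ x, χ x * (u k x - v x) ^ 2 ∂μ) atTop (𝓝 0) := by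
    refine tendsto_integral_cutoff_mul_sq hD husub (M := 2 * M + 2 * ∫ x, ‖H x‖ ^ 2 ∂μ)
      (C := ∫ x, f x ∂μ) (fun k => ?_) (fun k => integral_mono_ae (hsq k) hf (hsqf k)) ?_
    · refine (integral_norm_sub_sq_le (hu k).memLp_gradient hv.memLp_gradient).trans ?_
      gcongr
      exact hM k
    · intro S hS
      have h := (hw S hS).sub_const (∫ x in S, v x ∂μ)
      rw [sub_self] at h
      refine h.congr fun k => ?_
      rw [integral_sub]
      · exact ((hu k).memLp.integrable (by norm_num)).restrict
      · exact (hv.memLp.integrable (by norm_num)).restrict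
  rw [Metric.tendsto_atTop]
  intro η hη
  obtain ⟨K, hK, hKD, hKη⟩ := exists_isCompact_integral_sub_lt hD hf (half_pos hη)
  obtain ⟨χ, hχ, hχK⟩ := TestFunction.exists_eq_one_of_isCompact hK hKD
  have hχ1 : ∀ x, |χ x| ≤ 1 := fun x => abs_le.2 ⟨by linarith [(hχ x).1], (hχ x).2⟩
  obtain ⟨N, hN⟩ := Metric.tendsto_atTop.1 (hloc χ hχ1) (η / 2) (half_pos hη)
  refine ⟨N, fun k hk => ?_⟩
  have h1 := hN k hk
  rw [Real.dist_0_eq_abs] at h1 ⊢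
  rw [abs_of_nonneg (integral_nonneg fun _ => sq_nonneg _)]
  have hχsq : Integrable (fun x => χ x * (u k x - v x) ^ 2) μ :=
    (hsq k).bdd_mul (c := 1) χ.continuous.aestronglyMeasurable (Eventually.of_forall hχ1)
  have hKf : (∫ x, f x ∂μ) - ∫ x in K, f x = ∫ x, f x - K.indicator f x ∂μ := by
    rw [integral_sub hf (hf.indicator hK.measurableSet), integral_indicator hK.measurableSet, hμ,
      Measure.restrict_restrict hK.measurableSet, Set.inter_eq_left.2 hKD]
  -- The part not seen by the cut-off vanishes on `K` and is at most `f` elsewhere, and `f` has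
  -- integral below `η / 2` outside `K`.
  have h2 : ∫ x, (u k x - v x) ^ 2 - χ x * (u k x - v x) ^ 2 ∂μ ≤
      ∫ x, f x - K.indicator f x ∂μ := by
    refine integral_mono_ae ((hsq k).sub hχsq) (hf.sub (hf.indicator hK.measurableSet)) ?_
    filter_upwards [hsqf k] with x hx
    by_cases hxK : x ∈ K
    · simp [hxK, hχK x hxK]
    · simp only [hxK, not_false_eq_true, Set.indicator_of_notMem, sub_zero]
      nlinarith [(hχ x).1, sq_nonneg (u k x - v x)]
  rw [integral_sub (hsq k) hχsq] at h2
  change (∫ x, f x ∂μ) - _ < _ at hKη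
  have := (abs_lt.1 h1).2
  linarith

end StrongConvergence

/-! ### Closedness and boundedness of `SO(n)` -/

section SpecialOrthogonal

variable {n : ℕ}

theorem mem_specialOrthogonalGroup_iff_transpose_mul {A : Matrix (Fin n) (Fin n) ℝ} :
    A ∈ Matrix.specialOrthogonalGroup (Fin n) ℝ ↔ A.transpose * A = 1 ∧ A.det = 1 := by
  rw [Matrix.mem_specialOrthogonalGroup_iff, Matrix.mem_orthogonalGroup_iff']

theorem isClosed_specialOrthogonalGroup :
    IsClosed {A : Matrix (Fin n) (Fin n) ℝ | A ∈ Matrix.specialOrthogonalGroup (Fin n) ℝ} := by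
  simp_rw [mem_specialOrthogonalGroup_iff_transpose_mul]
  exact (isClosed_eq (by fun_prop) continuous_const).inter
    (isClosed_eq (by fun_prop) continuous_const)

theorem sum_mul_of_mem_specialOrthogonalGroup {A : Matrix (Fin n) (Fin n) ℝ}
    (hA : A ∈ Matrix.specialOrthogonalGroup (Fin n) ℝ) (i j : Fin n) :
    ∑ k, A k i * A k j = if i = j then 1 else 0 := by
  have h := congrFun (congrFun (mem_specialOrthogonalGroup_iff_transpose_mul.1 hA).1 i) j
  simpa [Matrix.mul_apply, Matrix.one_apply] using h

theorem abs_apply_le_one_of_mem_specialOrthogonalGroup {A : Matrix (Fin n) (Fin n) ℝ}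
    (hA : A ∈ Matrix.specialOrthogonalGroup (Fin n) ℝ) (i j : Fin n) : |A i j| ≤ 1 := by
  have h := sum_mul_of_mem_specialOrthogonalGroup hA j j
  rw [if_pos rfl] at h
  have h1 : A i j * A i j ≤ 1 := by
    rw [← h]
    exact Finset.single_le_sum (f := fun k => A k j * A k j) (fun k _ => mul_self_nonneg _)
      (Finset.mem_univ i)
  rw [← sq_le_one_iff_abs_le_one]
  nlinarith

end SpecialOrthogonal

/-! ### Limits of products and almost everywhere convergent subsequences -/

section Products

variable {α : Type*} [MeasurableSpace α] {μ : Measure α}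

theorem tendsto_integral_mul_of_ae_bounded {f : α → ℝ} (hf : Integrable f μ) {u : ℕ → α → ℝ}
    {v : α → ℝ} (hu : ∀ k, AEStronglyMeasurable (u k) μ) (hb : ∀ k, ∀ᵐ x ∂μ, |u k x| ≤ 1)
    (huv : ∀ᵐ x ∂μ, Tendsto (fun k => u k x) atTop (𝓝 (v x))) :
    Tendsto (fun k => ∫ x, f x * u k x ∂μ) atTop (𝓝 (∫ x, f x * v x ∂μ)) := by
  refine tendsto_integral_of_dominated_convergence (fun x => |f x|)
    (fun k => hf.aestronglyMeasurable.mul (hu k)) hf.abs (fun k => ?_) ?_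
  · filter_upwards [hb k] with x hx
    rw [Real.norm_eq_abs, abs_mul]
    exact mul_le_of_le_one_right (abs_nonneg _) hx
  · filter_upwards [huv] with x hx
    exact hx.const_mul _

/-- The product of a weakly convergent sequence and a boundedly almost everywhere convergent
sequence. -/
theorem tendsto_integral_mul_of_weak_of_ae_bounded [IsFiniteMeasure μ] {g : ℕ → α → ℝ}
    {g' : α → ℝ} (hg : ∀ k, MemLp (g k) 2 μ) {M : ℝ} (hM : ∀ k, ∫ x, g k x ^ 2 ∂μ ≤ M)
    (hw : ∀ v, MemLp v 2 μ →
      Tendsto (fun k => ∫ x, g k x * v x ∂μ) atTop (𝓝 (∫ x, g' x * v x ∂μ)))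
    {u : ℕ → α → ℝ} {v : α → ℝ} (hu : ∀ k, AEStronglyMeasurable (u k) μ)
    (hv : AEStronglyMeasurable v μ) (hb : ∀ k, ∀ᵐ x ∂μ, |u k x| ≤ 1)
    (hvb : ∀ᵐ x ∂μ, |v x| ≤ 1)
    (huv : ∀ᵐ x ∂μ, Tendsto (fun k => u k x) atTop (𝓝 (v x))) :
    Tendsto (fun k => ∫ x, g k x * u k x ∂μ) atTop (𝓝 (∫ x, g' x * v x ∂μ)) := by
  have hu2 : ∀ k, MemLp (u k) 2 μ := fun k => MemLp.of_bound (hu k) 1 (hb k)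
  have hv2 : MemLp v 2 μ := MemLp.of_bound hv 1 hvb
  have huv2 : ∀ k, MemLp (fun x => u k x - v x) 2 μ := fun k => (hu2 k).sub hv2
  have h1 : Tendsto (fun k => ∫ x, (u k x - v x) ^ 2 ∂μ) atTop (𝓝 0) := by
    have h0 : (0 : ℝ) = ∫ _x : α, (0 : ℝ) ∂μ := by simp
    rw [h0]
    refine tendsto_integral_of_dominated_convergence (fun _ => (4 : ℝ))
      (fun k => ((hu k).sub hv).pow 2) (integrable_const _) (fun k => ?_) ?_
    · filter_upwards [hb k, hvb] with x h1 h2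
      rw [Real.norm_of_nonneg (sq_nonneg _)]
      rw [abs_le] at h1 h2
      nlinarith
    · filter_upwards [huv] with x hx
      simpa using (hx.sub_const (v x)).pow 2
  -- Split `g_k u_k = g_k (u_k - v) + g_k v`: the first term dies by Cauchy-Schwarz, the second
  -- converges weakly.
  have h2 : Tendsto (fun k => ∫ x, g k x * (u k x - v x) ∂μ) atTop (𝓝 0) := by
    have h3 : Tendsto (fun k => √M * √(∫ x, (u k x - v x) ^ 2 ∂μ)) atTop (𝓝 0) := by
      simpa using h1.sqrt.const_mul (√M)
    refine squeeze_zero_norm (fun k => ?_) h3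
    refine (abs_integral_mul_le_sqrt_mul_sqrt (hg k) (huv2 k)).trans ?_
    gcongr
    exact hM k
  have h4 := h2.add (hw v hv2)
  rw [zero_add] at h4
  refine h4.congr fun k => ?_
  rw [← integral_add (integrable_fun_mul (hg k) (huv2 k)) (integrable_fun_mul (hg k) hv2)]
  congr 1; ext x; ring

/-- Summing the squares over the finite index set gives one sequence tending to zero in `L¹`, hence
in measure, hence almost everywhere along a subsequence; each square is dominated by the sum. -/
theorem exists_subseq_tendsto_ae_of_integral_sq {ι : Type*} [Fintype ι] {u : ℕ → ι → α → ℝ}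
    {v : ι → α → ℝ} (hu : ∀ k i, MemLp (u k i) 2 μ) (hv : ∀ i, MemLp (v i) 2 μ)
    (h : ∀ i, Tendsto (fun k => ∫ x, (u k i x - v i x) ^ 2 ∂μ) atTop (𝓝 0)) :
    ∃ φ : ℕ → ℕ, StrictMono φ ∧
      ∀ᵐ x ∂μ, ∀ i, Tendsto (fun k => u (φ k) i x) atTop (𝓝 (v i x)) := by
  let F : ℕ → α → ℝ := fun k x => ∑ i, (u k i x - v i x) ^ 2
  have hi : ∀ k i, Integrable (fun x => (u k i x - v i x) ^ 2) μ := fun k i =>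
    ((hu k i).sub (hv i)).integrable_sq
  have hF : ∀ k, Integrable (F k) μ := fun k => integrable_finsetSum _ fun i _ => hi k i
  have hF0 : ∀ k x, 0 ≤ F k x := fun k x => Finset.sum_nonneg fun i _ => sq_nonneg _
  have hlim : Tendsto (fun k => ∫ x, F k x ∂μ) atTop (𝓝 0) := by
    have := tendsto_finsetSum Finset.univ fun i _ => h i
    simp only [Finset.sum_const_zero] at this
    refine this.congr fun k => ?_
    rw [integral_finsetSum _ fun i _ => hi k i]
  have hm : TendstoInMeasure μ F atTop 0 := by
    refine tendstoInMeasure_of_tendsto_eLpNorm (p := 1) one_ne_zero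
      (fun k => (hF k).aestronglyMeasurable) aestronglyMeasurable_zero ?_
    have h0 : Tendsto (fun k => ENNReal.ofReal (∫ x, F k x ∂μ)) atTop (𝓝 0) := by
      simpa using ENNReal.tendsto_ofReal hlim
    refine h0.congr fun k => ?_
    rw [sub_zero, eLpNorm_one_eq_lintegral_enorm,
      ofReal_integral_eq_lintegral_ofReal (hF k) (Eventually.of_forall (hF0 k))]
    refine lintegral_congr fun x => ?_
    rw [Real.enorm_of_nonneg (hF0 k x)]
  obtain ⟨φ, hφ, hae⟩ := hm.exists_seq_tendsto_ae
  refine ⟨φ, hφ, ?_⟩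
  filter_upwards [hae] with x hx i
  have h1 : Tendsto (fun k => (u (φ k) i x - v i x) ^ 2) atTop (𝓝 0) :=
    squeeze_zero (fun k => sq_nonneg _)
      (fun k => Finset.single_le_sum (f := fun i => (u (φ k) i x - v i x) ^ 2)
        (fun i _ => sq_nonneg _) (Finset.mem_univ i)) hx
  have h2 : Tendsto (fun k => |u (φ k) i x - v i x|) atTop (𝓝 0) := by
    simpa [Real.sqrt_sq_eq_abs] using h1.sqrt
  rw [tendsto_iff_norm_sub_tendsto_zero]
  exact h2

end Products

/-! ### Frames, covariant gradient and energy -/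

section Frames

variable {m n : ℕ} {D : Opens (Eucl m)}

/-- A frame in `W^{1,2}(D, SO(n))` for which `Pᵀ∇P` is skew-symmetric. -/
structure IsSkewFrame (D : Opens (Eucl m)) (P : Eucl m → Matrix (Fin n) (Fin n) ℝ)
    (dP : Eucl m → Matrix (Fin n) (Fin n) (Eucl m)) : Prop
    extends IsW12SOWithGradient D P dP where
  skew : ∀ᵐ x ∂(volume.restrict (D : Set (Eucl m))), ∀ i j,
    ∑ k, (P x k i • dP x k j + P x k j • dP x k i) = 0

/-- The covariant derivative `∇P - ΩP`. -/
noncomputable def covGrad (P : Eucl m → Matrix (Fin n) (Fin n) ℝ)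
    (dP Ω : Eucl m → Matrix (Fin n) (Fin n) (Eucl m)) :
    Eucl m → Matrix (Fin n) (Fin n) (Eucl m) :=
  fun x i j => dP x i j - ∑ l, P x l j • Ω x i l

/-- The energy `‖∇P - ΩP‖²` in `L²(D)`. -/
noncomputable def gaugeEnergy (D : Opens (Eucl m)) (P : Eucl m → Matrix (Fin n) (Fin n) ℝ)
    (dP Ω : Eucl m → Matrix (Fin n) (Fin n) (Eucl m)) : ℝ :=
  ∑ i, ∑ j, ∫ x in (D : Set (Eucl m)), ‖covGrad P dP Ω x i j‖ ^ 2

variable {P : Eucl m → Matrix (Fin n) (Fin n) ℝ}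
  {dP Ω : Eucl m → Matrix (Fin n) (Fin n) (Eucl m)}

theorem IsW12SOWithGradient.abs_le_one (h : IsW12SOWithGradient D P dP) (i j : Fin n) :
    ∀ᵐ x ∂(volume.restrict (D : Set (Eucl m))), |P x i j| ≤ 1 := by
  filter_upwards [h.mem_SO] with x hx
  exact abs_apply_le_one_of_mem_specialOrthogonalGroup hx i j

theorem IsW12SOWithGradient.memLp_top (h : IsW12SOWithGradient D P dP) (i j : Fin n) :
    MemLp (fun x => P x i j) ⊤ (volume.restrict (D : Set (Eucl m))) :=
  memLp_top_of_bound (h.entry i j).memLp.aestronglyMeasurable 1 (h.abs_le_one i j)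

theorem memLp_sum_smul (h : IsW12SOWithGradient D P dP)
    (hΩ : ∀ i j, MemLp (fun x => Ω x i j) 2 (volume.restrict (D : Set (Eucl m)))) (i j : Fin n) :
    MemLp (fun x => ∑ l, P x l j • Ω x i l) 2 (volume.restrict (D : Set (Eucl m))) :=
  memLp_finsetSum _ fun l _ => (hΩ i l).smul (h.memLp_top l j) (r := 2)

theorem memLp_covGrad (h : IsW12SOWithGradient D P dP)
    (hΩ : ∀ i j, MemLp (fun x => Ω x i j) 2 (volume.restrict (D : Set (Eucl m)))) (i j : Fin n) :
    MemLp (fun x => covGrad P dP Ω x i j) 2 (volume.restrict (D : Set (Eucl m))) :=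
  (h.entry i j).memLp_gradient.sub (memLp_sum_smul h hΩ i j)

/-- Coercivity: write `∇P = (∇P - ΩP) + ΩP` and use `|P_lj| ≤ 1`. The `Ω` term does not depend on
`P`. -/
theorem integral_norm_gradient_sq_le (h : IsW12SOWithGradient D P dP)
    (hΩ : ∀ i j, MemLp (fun x => Ω x i j) 2 (volume.restrict (D : Set (Eucl m)))) (i j : Fin n) :
    ∫ x in (D : Set (Eucl m)), ‖dP x i j‖ ^ 2 ≤ 2 * gaugeEnergy D P dP Ω +
      2 * ∑ i, ∫ x in (D : Set (Eucl m)), (∑ l, ‖Ω x i l‖) ^ 2 := by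
  have h1 := integral_norm_sub_sq_le (memLp_covGrad h hΩ i j) (memLp_sum_smul h hΩ i j).neg
  have e : ∀ x, covGrad P dP Ω x i j - (-(fun x => ∑ l, P x l j • Ω x i l)) x = dP x i j := by
    intro x; simp [covGrad]
  simp_rw [e] at h1
  refine h1.trans ?_
  have h2 : ∫ x in (D : Set (Eucl m)), ‖covGrad P dP Ω x i j‖ ^ 2 ≤ gaugeEnergy D P dP Ω := by
    have hn : ∀ i j, 0 ≤ ∫ x in (D : Set (Eucl m)), ‖covGrad P dP Ω x i j‖ ^ 2 := fun i j =>
      integral_nonneg fun x => by positivity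
    exact (Finset.single_le_sum (f := fun j => ∫ x in (D : Set (Eucl m)),
        ‖covGrad P dP Ω x i j‖ ^ 2) (fun j _ => hn i j) (Finset.mem_univ j)).trans
      (Finset.single_le_sum (f := fun i => ∑ j, ∫ x in (D : Set (Eucl m)),
        ‖covGrad P dP Ω x i j‖ ^ 2) (fun i _ => Finset.sum_nonneg fun j _ => hn i j)
        (Finset.mem_univ i))
  have hsum : MemLp (fun x => ∑ l, ‖Ω x i l‖) 2 (volume.restrict (D : Set (Eucl m))) :=
    memLp_finsetSum _ fun l _ => (hΩ i l).norm
  have h3 : ∫ x in (D : Set (Eucl m)), ‖(-(fun x => ∑ l, P x l j • Ω x i l)) x‖ ^ 2 ≤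
      ∫ x in (D : Set (Eucl m)), (∑ l, ‖Ω x i l‖) ^ 2 := by
    refine integral_mono_ae ((memLp_sum_smul h hΩ i j).neg.integrable_norm_pow (by simp))
      hsum.integrable_sq ?_
    filter_upwards [h.mem_SO] with x hx
    simp only [Pi.neg_apply, norm_neg]
    gcongr
    refine (norm_sum_le _ _).trans (Finset.sum_le_sum fun l _ => ?_)
    rw [norm_smul]
    exact mul_le_of_le_one_left (norm_nonneg _)
      (abs_apply_le_one_of_mem_specialOrthogonalGroup hx l j)
  have h4 : ∫ x in (D : Set (Eucl m)), (∑ l, ‖Ω x i l‖) ^ 2 ≤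
      ∑ i, ∫ x in (D : Set (Eucl m)), (∑ l, ‖Ω x i l‖) ^ 2 :=
    Finset.single_le_sum (f := fun i => ∫ x in (D : Set (Eucl m)), (∑ l, ‖Ω x i l‖) ^ 2)
      (fun i _ => integral_nonneg fun x => sq_nonneg _) (Finset.mem_univ i)
  linarith

end Frames

/-! ### Closure of the class of frames and lower semicontinuity -/

section Closure

theorem integrable_inner_of_memLp {α E : Type*} [MeasurableSpace α] {μ : Measure α}
    [NormedAddCommGroup E] [InnerProductSpace ℝ E] {f g : α → E} (hf : MemLp f 2 μ)
    (hg : MemLp g 2 μ) : Integrable (fun x => inner ℝ (f x) (g x)) μ := by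
  refine (L2.integrable_inner (𝕜 := ℝ) (hf.toLp f) (hg.toLp g)).congr ?_
  filter_upwards [hf.coeFn_toLp, hg.coeFn_toLp] with x hx hy
  rw [hx, hy]

variable {m n : ℕ} {D : Opens (Eucl m)}

/-- For fixed `φ` both sides of the weak formulation are pairings with fixed `L²` functions, so the
identity passes to weak limits. -/
theorem IsW12WithGradient.of_tendsto {u : ℕ → Eucl m → ℝ} {G : ℕ → Eucl m → Eucl m}
    (h : ∀ k, IsW12WithGradient D (u k) (G k)) {v : Eucl m → ℝ} {H : Eucl m → Eucl m}
    (hv : MemLp v 2 (volume.restrict (D : Set (Eucl m))))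
    (hH : MemLp H 2 (volume.restrict (D : Set (Eucl m))))
    (huv : ∀ f, MemLp f 2 (volume.restrict (D : Set (Eucl m))) →
      Tendsto (fun k => ∫ x in (D : Set (Eucl m)), u k x * f x) atTop
        (𝓝 (∫ x in (D : Set (Eucl m)), v x * f x)))
    (hGH : ∀ a f, MemLp f 2 (volume.restrict (D : Set (Eucl m))) →
      Tendsto (fun k => ∫ x in (D : Set (Eucl m)), G k x a * f x) atTop
        (𝓝 (∫ x in (D : Set (Eucl m)), H x a * f x))) :
    IsW12WithGradient D v H where
  memLp := hv
  memLp_gradient := hH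
  integral_eq φ i := by
    refine tendsto_nhds_unique (huv _ (φ.memLp_fderiv _ 2 _)) ?_
    simp_rw [(h _).integral_eq]
    exact (hGH i φ (φ.memLp 2 _)).neg

theorem integral_apply_sq_le {G : Eucl m → Eucl m} {μ : Measure (Eucl m)} (hG : MemLp G 2 μ)
    (a : Fin m) : ∫ x, G x a ^ 2 ∂μ ≤ ∫ x, ‖G x‖ ^ 2 ∂μ := by
  refine integral_mono (hG.eval_piLp a).integrable_sq (hG.integrable_norm_pow (by simp))
    fun x => ?_
  have := PiLp.norm_apply_le (G x) a
  rw [Real.norm_eq_abs] at this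
  calc G x a ^ 2 = |G x a| ^ 2 := (sq_abs _).symm
    _ ≤ ‖G x‖ ^ 2 := by gcongr

variable {Ω : Eucl m → Matrix (Fin n) (Fin n) (Eucl m)}
  {P : ℕ → Eucl m → Matrix (Fin n) (Fin n) ℝ} {dP : ℕ → Eucl m → Matrix (Fin n) (Fin n) (Eucl m)}

/-- A sequence of frames with bounded gradients has a subsequence converging almost everywhere,
with weakly convergent gradients, to a frame. -/
theorem exists_subseq_tendsto_isW12SOWithGradient (hD : Bornology.IsBounded (D : Set (Eucl m)))
    (hP : ∀ k, IsW12SOWithGradient D (P k) (dP k)) {M : ℝ}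
    (hM : ∀ k i j, ∫ x in (D : Set (Eucl m)), ‖dP k x i j‖ ^ 2 ≤ M) :
    ∃ (Q : Eucl m → Matrix (Fin n) (Fin n) ℝ) (dQ : Eucl m → Matrix (Fin n) (Fin n) (Eucl m))
      (φ : ℕ → ℕ), StrictMono φ ∧ IsW12SOWithGradient D Q dQ ∧
      (∀ i j, ∀ᵐ x ∂(volume.restrict (D : Set (Eucl m))),
        Tendsto (fun k => P (φ k) x i j) atTop (𝓝 (Q x i j))) ∧
      ∀ i j a v, MemLp v 2 (volume.restrict (D : Set (Eucl m))) →
        Tendsto (fun k => ∫ x in (D : Set (Eucl m)), dP (φ k) x i j a * v x) atTop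
          (𝓝 (∫ x in (D : Set (Eucl m)), dQ x i j a * v x)) := by
  have := isFiniteMeasure_restrict_of_isBounded hD
  set μ := volume.restrict (D : Set (Eucl m))
  -- The index `none` stands for the entry of `P` itself and `some a` for its `a`-th weak
  -- derivative, so that one extraction treats them together.
  let f : ℕ → (Fin n × Fin n) × Option (Fin m) → Eucl m → ℝ := fun k p x =>
    p.2.elim (P k x p.1.1 p.1.2) fun a => dP k x p.1.1 p.1.2 a
  have hf : ∀ k p, MemLp (f k p) 2 μ := by
    rintro k ⟨⟨i, j⟩, _ | a⟩
    · exact ((hP k).entry i j).memLp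
    · exact ((hP k).entry i j).memLp_gradient.eval_piLp a
  have hfC : ∀ k p, ∫ x, f k p x ^ 2 ∂μ ≤ max M (μ.real Set.univ) := by
    rintro k ⟨⟨i, j⟩, _ | a⟩
    · refine le_max_of_le_right ?_
      have h1 : ∫ x, P k x i j ^ 2 ∂μ ≤ ∫ _x, (1 : ℝ) ∂μ := by
        refine integral_mono_ae ((hP k).entry i j).memLp.integrable_sq (integrable_const _) ?_
        filter_upwards [(hP k).abs_le_one i j] with x hx
        exact (sq_le_one_iff_abs_le_one _).2 hx
      simpa [f] using h1
    · exact le_max_of_le_left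
        ((integral_apply_sq_le ((hP k).entry i j).memLp_gradient a).trans (hM k i j))
  obtain ⟨g, φ, hφ, hg, hgw⟩ := exists_subseq_tendsto_integral_mul hf hfC
  let Q : Eucl m → Matrix (Fin n) (Fin n) ℝ := fun x i j => g ((i, j), none) x
  let dQ : Eucl m → Matrix (Fin n) (Fin n) (Eucl m) := fun x i j =>
    WithLp.toLp 2 fun a => g ((i, j), some a) x
  have hdQ : ∀ i j, MemLp (fun x => dQ x i j) 2 μ := fun i j =>
    MemLp.of_eval_piLp fun a => hg ((i, j), some a)
  have hQ : ∀ i j, IsW12WithGradient D (fun x => Q x i j) (fun x => dQ x i j) := fun i j =>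
    .of_tendsto (fun k => (hP (φ k)).entry i j) (hg _) (hdQ i j) (fun v hv => hgw ((i, j), none) v hv)
      (fun a v hv => hgw ((i, j), some a) v hv)
  have hstrong : ∀ i j, Tendsto (fun k => ∫ x, (P (φ k) x i j - Q x i j) ^ 2 ∂μ) atTop (𝓝 0) := by
    intro i j
    refine tendsto_integral_sub_sq hD (fun k => (hP (φ k)).entry i j) (hQ i j)
      (fun k => (hP (φ k)).abs_le_one i j) (fun k => hM (φ k) i j) fun S hS => ?_
    have h := hgw ((i, j), none) (S.indicator 1)
      ((memLp_const (1 : ℝ)).indicator hS)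
    have e : ∀ w : Eucl m → ℝ, ∫ x, w x * S.indicator 1 x ∂μ = ∫ x in S, w x ∂μ := by
      intro w
      rw [← integral_indicator hS]
      congr 1; ext x
      by_cases hx : x ∈ S <;> simp [hx]
    simp only [e] at h
    exact h
  obtain ⟨ψ, hψ, hae⟩ := exists_subseq_tendsto_ae_of_integral_sq
    (u := fun k (p : Fin n × Fin n) x => P (φ k) x p.1 p.2) (v := fun p x => Q x p.1 p.2)
    (fun k p => ((hP (φ k)).entry p.1 p.2).memLp) (fun p => (hQ p.1 p.2).memLp)
    (fun p => hstrong p.1 p.2)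
  refine ⟨Q, dQ, φ ∘ ψ, hφ.comp hψ, ⟨hQ, ?_⟩, fun i j => ?_, fun i j a v hv => ?_⟩
  · have hSO : ∀ᵐ x ∂μ, ∀ k, P k x ∈ Matrix.specialOrthogonalGroup (Fin n) ℝ :=
      ae_all_iff.2 fun k => (hP k).mem_SO
    filter_upwards [hae, hSO] with x hx hxP
    refine isClosed_specialOrthogonalGroup.mem_of_tendsto (f := fun k => P (φ (ψ k)) x)
      (b := atTop) ?_ (Eventually.of_forall fun k => hxP _)
    exact tendsto_pi_nhds.2 fun i => tendsto_pi_nhds.2 fun j => hx (i, j)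
  · filter_upwards [hae] with x hx
    exact hx (i, j)
  · exact (hgw ((i, j), some a) v hv).comp hψ.tendsto_atTop

/-- Skew-symmetry of `Pᵀ∇P` passes to the limit. -/
theorem isSkewFrame_of_tendsto (hD : Bornology.IsBounded (D : Set (Eucl m)))
    (hP : ∀ k, IsSkewFrame D (P k) (dP k)) {M : ℝ}
    (hM : ∀ k i j, ∫ x in (D : Set (Eucl m)), ‖dP k x i j‖ ^ 2 ≤ M)
    {Q : Eucl m → Matrix (Fin n) (Fin n) ℝ} {dQ : Eucl m → Matrix (Fin n) (Fin n) (Eucl m)}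
    (hQ : IsW12SOWithGradient D Q dQ)
    (hPQ : ∀ i j, ∀ᵐ x ∂(volume.restrict (D : Set (Eucl m))),
      Tendsto (fun k => P k x i j) atTop (𝓝 (Q x i j)))
    (hdPQ : ∀ i j a v, MemLp v 2 (volume.restrict (D : Set (Eucl m))) →
      Tendsto (fun k => ∫ x in (D : Set (Eucl m)), dP k x i j a * v x) atTop
        (𝓝 (∫ x in (D : Set (Eucl m)), dQ x i j a * v x))) :
    IsSkewFrame D Q dQ := by
  have := isFiniteMeasure_restrict_of_isBounded hD
  refine ⟨hQ, ?_⟩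
  set μ := volume.restrict (D : Set (Eucl m))
  have hprod : ∀ {P : Eucl m → Matrix (Fin n) (Fin n) ℝ}
      {dP : Eucl m → Matrix (Fin n) (Fin n) (Eucl m)}, IsW12SOWithGradient D P dP →
      ∀ i j a k, Integrable (fun x => P x k i * dP x k j a + P x k j * dP x k i a) μ := by
    intro P dP h i j a k
    exact (integrable_fun_mul (h.entry k i).memLp ((h.entry k j).memLp_gradient.eval_piLp a)).add
      (integrable_fun_mul (h.entry k j).memLp ((h.entry k i).memLp_gradient.eval_piLp a))
  have key : ∀ i j a, ∀ᵐ x ∂μ, ∑ k, (Q x k i * dQ x k j a + Q x k j * dQ x k i a) = 0 := by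
    intro i j a
    have hint : Integrable (fun x => ∑ k, (Q x k i * dQ x k j a + Q x k j * dQ x k i a)) μ :=
      integrable_finsetSum _ fun k _ => hprod hQ i j a k
    refine hint.ae_eq_zero_of_forall_setIntegral_eq_zero fun S hS _ => ?_
    -- Each term is a product of a strongly and a weakly convergent factor; restricting to `S` is
    -- absorbed by multiplying the bounded factor by the indicator.
    have hlim : ∀ p q r s, Tendsto (fun k => ∫ x in S, P k x p q * dP k x r s a ∂μ) atTop
        (𝓝 (∫ x in S, Q x p q * dQ x r s a ∂μ)) := by
      intro p q r s
      have h := tendsto_integral_mul_of_weak_of_ae_bounded (μ := μ)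
        (g := fun k x => dP k x r s a) (g' := fun x => dQ x r s a)
        (fun k => ((hP k).entry r s).memLp_gradient.eval_piLp a)
        (M := M) (fun k => (integral_apply_sq_le ((hP k).entry r s).memLp_gradient a).trans
          (hM k r s)) (hdPQ r s a)
        (u := fun k => S.indicator fun x => P k x p q) (v := S.indicator fun x => Q x p q)
        (fun k => ((hP k).entry p q).memLp.aestronglyMeasurable.indicator hS)
        ((hQ.entry p q).memLp.aestronglyMeasurable.indicator hS)
        (fun k => by
          filter_upwards [(hP k).abs_le_one p q] with x hx
          by_cases hxS : x ∈ S <;> simp [hxS, hx])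
        (by
          filter_upwards [hQ.abs_le_one p q] with x hx
          by_cases hxS : x ∈ S <;> simp [hxS, hx])
        (by
          filter_upwards [hPQ p q] with x hx
          by_cases hxS : x ∈ S <;> simp [hxS, hx])
      have e : ∀ v w : Eucl m → ℝ, ∫ x, w x * S.indicator v x ∂μ = ∫ x in S, v x * w x ∂μ := by
        intro v w
        rw [← integral_indicator hS]
        congr 1; ext x
        by_cases hx : x ∈ S <;> simp [hx, mul_comm]
      simpa only [e] using h
    have hsum := tendsto_finsetSum Finset.univ fun k _ => (hlim k i k j).add (hlim k j k i)
    have e : ∀ {P : Eucl m → Matrix (Fin n) (Fin n) ℝ}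
      {dP : Eucl m → Matrix (Fin n) (Fin n) (Eucl m)}, IsW12SOWithGradient D P dP →
        ∑ k, (∫ x in S, P x k i * dP x k j a ∂μ + ∫ x in S, P x k j * dP x k i a ∂μ) =
          ∫ x in S, ∑ k, (P x k i * dP x k j a + P x k j * dP x k i a) ∂μ := by
      intro P dP h
      rw [integral_finsetSum _ fun k _ => (hprod h i j a k).restrict]
      refine Finset.sum_congr rfl fun k _ => ?_
      rw [integral_add]
      · exact (integrable_fun_mul (h.entry k i).memLp
          ((h.entry k j).memLp_gradient.eval_piLp a)).restrict
      · exact (integrable_fun_mul (h.entry k j).memLp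
          ((h.entry k i).memLp_gradient.eval_piLp a)).restrict
    rw [e hQ] at hsum
    refine tendsto_nhds_unique hsum ?_
    have h0 : ∀ k, ∑ l, (∫ x in S, P k x l i * dP k x l j a ∂μ +
        ∫ x in S, P k x l j * dP k x l i a ∂μ) = 0 := by
      intro k
      rw [e (hP k).toIsW12SOWithGradient]
      have : ∀ᵐ x ∂(μ.restrict S), ∑ l, (P k x l i * dP k x l j a + P k x l j * dP k x l i a) =
          (0 : ℝ) := by
        filter_upwards [ae_restrict_of_ae (hP k).skew] with x hx
        have := congrArg (fun v : Eucl m => v a) (hx i j)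
        simpa using this
      rw [integral_congr_ae this, integral_zero]
    simp only [h0]
    exact tendsto_const_nhds
  have key' : ∀ᵐ x ∂μ, ∀ i j a, ∑ k, (Q x k i * dQ x k j a + Q x k j * dQ x k i a) = 0 :=
    ae_all_iff.2 fun i => ae_all_iff.2 fun j => ae_all_iff.2 fun a => key i j a
  filter_upwards [key'] with x hx i j
  ext a
  simpa using hx i j a

/-- Lower semicontinuity of the gauge energy. -/
theorem gaugeEnergy_le_of_tendsto (hP : ∀ k, IsW12SOWithGradient D (P k) (dP k))
    (hΩ : ∀ i j, MemLp (fun x => Ω x i j) 2 (volume.restrict (D : Set (Eucl m))))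
    {Q : Eucl m → Matrix (Fin n) (Fin n) ℝ} {dQ : Eucl m → Matrix (Fin n) (Fin n) (Eucl m)}
    (hQ : IsW12SOWithGradient D Q dQ)
    (hPQ : ∀ i j, ∀ᵐ x ∂(volume.restrict (D : Set (Eucl m))),
      Tendsto (fun k => P k x i j) atTop (𝓝 (Q x i j)))
    (hdPQ : ∀ i j a v, MemLp v 2 (volume.restrict (D : Set (Eucl m))) →
      Tendsto (fun k => ∫ x in (D : Set (Eucl m)), dP k x i j a * v x) atTop
        (𝓝 (∫ x in (D : Set (Eucl m)), dQ x i j a * v x)))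
    {L : ℝ} (hL : Tendsto (fun k => gaugeEnergy D (P k) (dP k) Ω) atTop (𝓝 L)) :
    gaugeEnergy D Q dQ Ω ≤ L := by
  set μ := volume.restrict (D : Set (Eucl m))
  have hH : ∀ i j, MemLp (fun x => covGrad Q dQ Ω x i j) 2 μ := memLp_covGrad hQ hΩ
  -- Pairing with the fixed limit `∇Q - ΩQ` is linear in `(P, ∇P)`, so only weak convergence of `∇P`
  -- and dominated convergence for `P` are needed.
  have hexp : ∀ {P : Eucl m → Matrix (Fin n) (Fin n) ℝ}
      {dP : Eucl m → Matrix (Fin n) (Fin n) (Eucl m)}, IsW12SOWithGradient D P dP → ∀ i j,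
      ∫ x, inner ℝ (covGrad P dP Ω x i j) (covGrad Q dQ Ω x i j) ∂μ =
        ∑ a, ∫ x, dP x i j a * covGrad Q dQ Ω x i j a ∂μ -
        ∑ l, ∫ x, inner ℝ (Ω x i l) (covGrad Q dQ Ω x i j) * P x l j ∂μ := by
    intro P dP h i j
    have h1 : ∀ a, Integrable (fun x => dP x i j a * covGrad Q dQ Ω x i j a) μ := fun a =>
      integrable_fun_mul ((h.entry i j).memLp_gradient.eval_piLp a) ((hH i j).eval_piLp a)
    have h2 : ∀ l, Integrable (fun x => inner ℝ (Ω x i l) (covGrad Q dQ Ω x i j) * P x l j) μ :=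
      fun l => (integrable_inner_of_memLp (hΩ i l) (hH i j)).mul_bdd (c := 1)
        (h.entry l j).memLp.aestronglyMeasurable (h.abs_le_one l j)
    rw [← integral_finsetSum _ fun a _ => h1 a, ← integral_finsetSum _ fun l _ => h2 l,
      ← integral_sub (integrable_finsetSum _ fun a _ => h1 a)
        (integrable_finsetSum _ fun l _ => h2 l)]
    congr 1; ext x
    rw [covGrad, inner_sub_left, sum_inner, PiLp.inner_apply]
    congr 1
    · exact Finset.sum_congr rfl fun a _ => by simp [mul_comm, covGrad]
    · refine Finset.sum_congr rfl fun l _ => ?_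
      rw [real_inner_smul_left, mul_comm]
  have hlim : Tendsto (fun k => ∑ i, ∑ j,
      ∫ x, inner ℝ (covGrad (P k) (dP k) Ω x i j) (covGrad Q dQ Ω x i j) ∂μ) atTop
      (𝓝 (gaugeEnergy D Q dQ Ω)) := by
    have e : gaugeEnergy D Q dQ Ω = ∑ i, ∑ j,
        ∫ x, inner ℝ (covGrad Q dQ Ω x i j) (covGrad Q dQ Ω x i j) ∂μ := by
      simp [gaugeEnergy, μ]
    rw [e]
    refine tendsto_finsetSum _ fun i _ => tendsto_finsetSum _ fun j _ => ?_
    rw [hexp hQ]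
    simp_rw [hexp (hP _)]
    refine Tendsto.sub (tendsto_finsetSum _ fun a _ => hdPQ i j a _ ((hH i j).eval_piLp a))
      (tendsto_finsetSum _ fun l _ => ?_)
    exact tendsto_integral_mul_of_ae_bounded (integrable_inner_of_memLp (hΩ i l) (hH i j))
      (fun k => ((hP k).entry l j).memLp.aestronglyMeasurable) (fun k => (hP k).abs_le_one l j)
      (hPQ l j)
  -- From `⟨a, b⟩ ≤ (|a|² + |b|²) / 2`, the limit satisfies `E(Q) ≤ (L + E(Q)) / 2`, which is `E(Q)
  -- ≤ L`.
  have hle : ∀ k, ∑ i, ∑ j,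
      ∫ x, inner ℝ (covGrad (P k) (dP k) Ω x i j) (covGrad Q dQ Ω x i j) ∂μ ≤
      (gaugeEnergy D (P k) (dP k) Ω + gaugeEnergy D Q dQ Ω) / 2 := by
    intro k
    simp only [gaugeEnergy, ← Finset.sum_add_distrib, Finset.sum_div]
    refine Finset.sum_le_sum fun i _ => Finset.sum_le_sum fun j _ => ?_
    have hA := memLp_covGrad (hP k) hΩ i j
    have hA2 := hA.integrable_norm_pow (by simp)
    have hH2 := (hH i j).integrable_norm_pow (by simp)
    rw [← integral_add hA2 hH2, ← integral_div]
    refine integral_mono (integrable_inner_of_memLp hA (hH i j)) ((hA2.add hH2).div_const 2) fun x => ?_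
    have h1 := real_inner_le_norm (covGrad (P k) (dP k) Ω x i j) (covGrad Q dQ Ω x i j)
    have h2 := sq_nonneg (‖covGrad (P k) (dP k) Ω x i j‖ - ‖covGrad Q dQ Ω x i j‖)
    simp only
    linarith
  have := le_of_tendsto_of_tendsto' hlim ((hL.add_const _).div_const 2) hle
  linarith

end Closure

/-! ### Existence of a minimiser -/

section Minimizer

variable {m n : ℕ} {D : Opens (Eucl m)}

theorem TestFunction.integral_fderiv_eq_zero (φ : 𝓓(D, ℝ)) (y : Eucl m) :
    ∫ x in (D : Set (Eucl m)), fderiv ℝ φ x y = 0 := by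
  have hs : ∀ x, x ∉ (D : Set (Eucl m)) → fderiv ℝ φ x y = 0 := by
    intro x hx
    have : x ∉ tsupport φ := fun h => hx (φ.tsupport_subset h)
    rw [fderiv_of_notMem_tsupport ℝ this]; rfl
  rw [setIntegral_eq_integral_of_forall_compl_eq_zero hs]
  have h := integral_mul_fderiv_eq_neg_fderiv_mul_of_integrable (μ := (volume : Measure (Eucl m)))
    (f := fun _ => (1 : ℝ)) (g := φ) (v := y) (by simp)
    (by simpa using memLp_one_iff_integrable.1 (φ.memLp_fderiv y 1 volume))
    (by simpa using memLp_one_iff_integrable.1 (φ.memLp 1 volume))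
    (by fun_prop) fun x _ => (φ.contDiff.differentiable (by simp)).differentiableAt
  simpa using h

theorem isW12WithGradient_const (hD : Bornology.IsBounded (D : Set (Eucl m))) (c : ℝ) :
    IsW12WithGradient D (fun _ => c) (fun _ => 0) where
  memLp := by
    have := isFiniteMeasure_restrict_of_isBounded hD
    exact memLp_const c
  memLp_gradient := MemLp.zero
  integral_eq φ i := by
    rw [integral_const_mul, φ.integral_fderiv_eq_zero]; simp

/-- The identity frame shows that the class is non-empty and is the competitor behind the final
estimate. -/
theorem isSkewFrame_one (hD : Bornology.IsBounded (D : Set (Eucl m))) :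
    IsSkewFrame D (fun _ => (1 : Matrix (Fin n) (Fin n) ℝ)) (fun _ => 0) where
  entry i j := isW12WithGradient_const hD _
  mem_SO := Eventually.of_forall fun _ => one_mem _
  skew := Eventually.of_forall fun x i j => by simp

theorem gaugeEnergy_nonneg (P : Eucl m → Matrix (Fin n) (Fin n) ℝ)
    (dP Ω : Eucl m → Matrix (Fin n) (Fin n) (Eucl m)) : 0 ≤ gaugeEnergy D P dP Ω :=
  Finset.sum_nonneg fun _ _ => Finset.sum_nonneg fun _ _ => integral_nonneg fun _ => by positivity

/-- The gauge energy attains its minimum. -/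
theorem exists_isSkewFrame_forall_gaugeEnergy_le (hD : Bornology.IsBounded (D : Set (Eucl m)))
    {Ω : Eucl m → Matrix (Fin n) (Fin n) (Eucl m)}
    (hΩ : ∀ i j, MemLp (fun x => Ω x i j) 2 (volume.restrict (D : Set (Eucl m)))) :
    ∃ (Q : Eucl m → Matrix (Fin n) (Fin n) ℝ) (dQ : Eucl m → Matrix (Fin n) (Fin n) (Eucl m)),
      IsSkewFrame D Q dQ ∧ ∀ P dP, IsSkewFrame D P dP →
        gaugeEnergy D Q dQ Ω ≤ gaugeEnergy D P dP Ω := by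
  let S : Set ℝ := {e | ∃ (P : Eucl m → Matrix (Fin n) (Fin n) ℝ)
    (dP : Eucl m → Matrix (Fin n) (Fin n) (Eucl m)), IsSkewFrame D P dP ∧
      gaugeEnergy D P dP Ω = e}
  have hS : S.Nonempty := ⟨_, _, _, isSkewFrame_one hD, rfl⟩
  have hSb : BddBelow S := by
    refine ⟨0, ?_⟩
    rintro _ ⟨P, dP, -, rfl⟩
    exact gaugeEnergy_nonneg P dP Ω
  obtain ⟨e, -, he, heS⟩ := exists_seq_tendsto_sInf hS hSb
  choose P dP hP hPe using heS
  obtain ⟨B, hB⟩ := he.bddAbove_range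
  have hM : ∀ k i j, ∫ x in (D : Set (Eucl m)), ‖dP k x i j‖ ^ 2 ≤
      2 * B + 2 * ∑ i, ∫ x in (D : Set (Eucl m)), (∑ l, ‖Ω x i l‖) ^ 2 := by
    intro k i j
    refine (integral_norm_gradient_sq_le (hP k).toIsW12SOWithGradient hΩ i j).trans ?_
    gcongr
    rw [hPe]
    exact hB ⟨k, rfl⟩
  obtain ⟨Q, dQ, φ, hφ, hQ, hPQ, hdPQ⟩ := exists_subseq_tendsto_isW12SOWithGradient hD
    (fun k => (hP k).toIsW12SOWithGradient) hM
  have hlim : Tendsto (fun k => gaugeEnergy D (P (φ k)) (dP (φ k)) Ω) atTop (𝓝 (sInf S)) := by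
    simp_rw [hPe]
    exact he.comp hφ.tendsto_atTop
  refine ⟨Q, dQ, isSkewFrame_of_tendsto hD (fun k => hP (φ k)) (fun k => hM (φ k)) hQ hPQ hdPQ,
    fun P' dP' hP' => ?_⟩
  exact (gaugeEnergy_le_of_tendsto (fun k => (hP (φ k)).toIsW12SOWithGradient) hΩ hQ hPQ hdPQ
    hlim).trans (csInf_le hSb ⟨P', dP', hP', rfl⟩)

end Minimizer

/-! ### Rotations generated by elementary skew matrices -/

section Rotation

open Matrix

variable {n : ℕ}

/-- The rotation `exp (t α)`, given by the formula of Rodrigues, for a skew-symmetric `α` with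
`α³ = -α`. -/
noncomputable def rodrigues (α : Matrix (Fin n) (Fin n) ℝ) (t : ℝ) : Matrix (Fin n) (Fin n) ℝ :=
  1 + Real.sin t • α + (1 - Real.cos t) • (α * α)

variable {α : Matrix (Fin n) (Fin n) ℝ}

theorem rodrigues_zero : rodrigues α 0 = 1 := by simp [rodrigues]

/-- Since `α³ = -α`, the span of `1`, `α`, `α²` is closed under products, and the group law reduces
to the addition formulas for sine and cosine. -/
theorem rodrigues_mul_rodrigues (hα : α * α * α = -α) (s t : ℝ) :
    rodrigues α s * rodrigues α t = rodrigues α (s + t) := by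
  have h2 : α * (α * α) = -α := by rw [← mul_assoc, hα]
  have h3 : α * α * (α * α) = -(α * α) := by rw [← mul_assoc, hα, neg_mul]
  simp only [rodrigues, add_mul, mul_add, one_mul, mul_one, smul_mul_assoc, mul_smul_comm, hα, h2,
    h3, Real.sin_add, Real.cos_add]
  module

theorem rodrigues_transpose (hαT : αᵀ = -α) (t : ℝ) : (rodrigues α t)ᵀ = rodrigues α (-t) := by
  simp [rodrigues, transpose_mul, hαT]

theorem rodrigues_transpose_mul_self (hαT : αᵀ = -α) (hα : α * α * α = -α) (t : ℝ) :
    (rodrigues α t)ᵀ * rodrigues α t = 1 := by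
  rw [rodrigues_transpose hαT, rodrigues_mul_rodrigues hα, neg_add_cancel, rodrigues_zero]

theorem rodrigues_mem_specialOrthogonalGroup (hαT : αᵀ = -α) (hα : α * α * α = -α) (t : ℝ) :
    rodrigues α t ∈ specialOrthogonalGroup (Fin n) ℝ := by
  rw [mem_specialOrthogonalGroup_iff_transpose_mul]
  refine ⟨rodrigues_transpose_mul_self hαT hα t, ?_⟩
  -- Orthogonality alone leaves the sign of the determinant open; as `R(t) = R(t/2)²`, the
  -- determinant is the square of `det R(t/2)`, which is `1`.
  have h := congrArg det (rodrigues_transpose_mul_self hαT hα (t / 2))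
  rw [det_mul, det_transpose, det_one] at h
  rw [← add_halves t, ← rodrigues_mul_rodrigues hα, det_mul, h]

theorem mul_rodrigues_comm (t : ℝ) : α * rodrigues α t = rodrigues α t * α := by
  simp [rodrigues, mul_add, add_mul, mul_assoc]

theorem rodrigues_mul (hα : α * α * α = -α) (t : ℝ) :
    rodrigues α t * α = Real.cos t • α + Real.sin t • (α * α) := by
  simp only [rodrigues, add_mul, one_mul, smul_mul_assoc, hα]
  module

theorem contDiff_rodrigues_apply (i j : Fin n) : ContDiff ℝ ∞ fun t => rodrigues α t i j := by
  simp only [rodrigues, Matrix.add_apply, Matrix.smul_apply, smul_eq_mul]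
  fun_prop

theorem hasDerivAt_rodrigues_apply (hα : α * α * α = -α) (i j : Fin n) (t : ℝ) :
    HasDerivAt (fun t => rodrigues α t i j) ((rodrigues α t * α) i j) t := by
  rw [rodrigues_mul hα]
  simp only [rodrigues, Matrix.add_apply, Matrix.smul_apply, smul_eq_mul]
  have h := (((Real.hasDerivAt_sin t).mul_const (α i j)).const_add ((1 : Matrix _ _ ℝ) i j)).fun_add
    (((Real.hasDerivAt_cos t).const_sub 1).mul_const ((α * α) i j))
  simpa using h

/-- The standard generators of `so(n)`. -/
def skewSingle (i j : Fin n) : Matrix (Fin n) (Fin n) ℝ := single i j 1 - single j i 1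

theorem skewSingle_transpose (i j : Fin n) : (skewSingle i j)ᵀ = -skewSingle i j := by
  simp [skewSingle]

theorem skewSingle_pow_three {i j : Fin n} (hij : i ≠ j) :
    skewSingle i j * skewSingle i j * skewSingle i j = -skewSingle i j := by
  simp [skewSingle, mul_sub, sub_mul, hij, hij.symm]
  abel

theorem trace_transpose_mul_skewSingle (N : Matrix (Fin n) (Fin n) ℝ) (i j : Fin n) :
    trace (Nᵀ * skewSingle i j) = N i j - N j i := by
  simp [skewSingle, mul_sub, trace_sub, trace_mul_single]

end Rotation

/-! ### Products of Sobolev functions with smooth functions -/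

section ProductRule

variable {m : ℕ} {D : Opens (Eucl m)} {u : Eucl m → ℝ} {G : Eucl m → Eucl m}

theorem gradient_apply_eq_fderiv (f : Eucl m → ℝ) (x : Eucl m) (a : Fin m) :
    gradient f x a = fderiv ℝ f x (EuclideanSpace.single a 1) := by
  rw [← InnerProductSpace.toDual_symm_apply (𝕜 := ℝ), EuclideanSpace.inner_single_right]
  simp [gradient]

theorem continuous_gradient {f : Eucl m → ℝ} (hf : ContDiff ℝ ∞ f) : Continuous (gradient f) :=
  (InnerProductSpace.toDual ℝ (Eucl m)).symm.continuous.comp (hf.continuous_fderiv (by simp))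

theorem norm_gradient (f : Eucl m → ℝ) (x : Eucl m) : ‖gradient f x‖ = ‖fderiv ℝ f x‖ :=
  LinearIsometryEquiv.norm_map _ _

theorem TestFunction.exists_norm_gradient_le (φ : 𝓓(D, ℝ)) : ∃ C, ∀ x, ‖gradient φ x‖ ≤ C := by
  obtain ⟨C, hC⟩ := (φ.contDiff.continuous_fderiv (by simp)).bounded_above_of_compact_support
    (φ.hasCompactSupport.fderiv ℝ)
  exact ⟨C, fun x => (norm_gradient φ x).trans_le (hC x)⟩

/-- The product of a test function and a smooth function. -/
noncomputable def TestFunction.smoothMul {η : Eucl m → ℝ} (hη : ContDiff ℝ ∞ η) (φ : 𝓓(D, ℝ)) : 𝓓(D, ℝ) where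
  toFun x := η x * φ x
  contDiff' := hη.mul φ.contDiff
  hasCompactSupport' := φ.hasCompactSupport.mul_left
  tsupport_subset' := tsupport_mul_subset_right.trans φ.tsupport_subset

theorem IsW12WithGradient.mul_smooth (h : IsW12WithGradient D u G) {η : Eucl m → ℝ}
    (hη : ContDiff ℝ ∞ η) {C C' : ℝ} (hC : ∀ x, |η x| ≤ C) (hC' : ∀ x, ‖gradient η x‖ ≤ C') :
    IsW12WithGradient D (fun x => u x * η x) (fun x => η x • G x + u x • gradient η x) where
  memLp := (memLp_top_of_bound hη.continuous.aestronglyMeasurable C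
    (Eventually.of_forall hC)).mul h.memLp (r := 2)
  memLp_gradient := by
    refine MemLp.add ?_ ?_
    · exact h.memLp_gradient.smul (memLp_top_of_bound hη.continuous.aestronglyMeasurable C
        (Eventually.of_forall hC)) (r := 2)
    · exact (memLp_top_of_bound (continuous_gradient hη).aestronglyMeasurable C'
        (Eventually.of_forall hC')).smul h.memLp (r := 2)
  integral_eq φ i := by
    have hηm : MemLp η ⊤ (volume.restrict (D : Set (Eucl m))) :=
      memLp_top_of_bound hη.continuous.aestronglyMeasurable C (Eventually.of_forall hC)
    have hgm : MemLp (fun x => gradient η x i) ⊤ (volume.restrict (D : Set (Eucl m))) :=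
      (memLp_top_of_bound (continuous_gradient hη).aestronglyMeasurable C'
        (Eventually.of_forall hC')).eval_piLp i
    have hGi : MemLp (fun x => G x i) 2 (volume.restrict (D : Set (Eucl m))) :=
      h.memLp_gradient.eval_piLp i
    have hφ2 := φ.memLp 2 (volume.restrict (D : Set (Eucl m)))
    have h1 : Integrable (fun x => u x * (gradient η x i * φ x))
        (volume.restrict (D : Set (Eucl m))) := integrable_fun_mul h.memLp (hφ2.mul hgm)
    have h2 : Integrable (fun x => u x * (η x * fderiv ℝ φ x (EuclideanSpace.single i 1)))
        (volume.restrict (D : Set (Eucl m))) :=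
      integrable_fun_mul h.memLp ((φ.memLp_fderiv _ 2 _).mul hηm)
    have h3 : Integrable (fun x => G x i * (η x * φ x)) (volume.restrict (D : Set (Eucl m))) :=
      integrable_fun_mul hGi (hφ2.mul hηm)
    -- Test with `ηφ`; the classical product rule for its derivative produces the extra gradient
    -- term.
    have key := h.integral_eq (φ.smoothMul hη) i
    have hd : ∀ x, fderiv ℝ (φ.smoothMul hη) x (EuclideanSpace.single i 1) =
        η x * fderiv ℝ φ x (EuclideanSpace.single i 1) + gradient η x i * φ x := by
      intro x
      change fderiv ℝ (fun x => η x * φ x) x _ = _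
      rw [fderiv_fun_mul (hη.differentiable (by simp)).differentiableAt
        (φ.contDiff.differentiable (by simp)).differentiableAt, gradient_apply_eq_fderiv]
      simp [mul_comm]
    simp only [hd, mul_add] at key
    rw [integral_add h2 h1] at key
    have e1 : ∫ x in (D : Set (Eucl m)), u x * η x * fderiv ℝ φ x (EuclideanSpace.single i 1) =
        ∫ x in (D : Set (Eucl m)), u x * (η x * fderiv ℝ φ x (EuclideanSpace.single i 1)) := by
      congr 1; ext x; ring
    have e2 : ∫ x in (D : Set (Eucl m)), (η x • G x + u x • gradient η x) i * φ x =
        (∫ x in (D : Set (Eucl m)), G x i * (η x * φ x)) +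
          ∫ x in (D : Set (Eucl m)), u x * (gradient η x i * φ x) := by
      rw [← integral_add h3 h1]
      congr 1; ext x
      simp only [PiLp.add_apply, PiLp.smul_apply, smul_eq_mul]
      ring
    change _ = -∫ x in (D : Set (Eucl m)), G x i * (η x * φ x) at key
    rw [e1, e2]
    linarith

theorem IsW12WithGradient.add {v : Eucl m → ℝ} {H : Eucl m → Eucl m}
    (hu : IsW12WithGradient D u G) (hv : IsW12WithGradient D v H) :
    IsW12WithGradient D (fun x => u x + v x) (fun x => G x + H x) where
  memLp := hu.memLp.add hv.memLp
  memLp_gradient := hu.memLp_gradient.add hv.memLp_gradient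
  integral_eq φ i := by
    have h1 := hu.integral_eq φ i
    have h2 := hv.integral_eq φ i
    simp only [add_mul, PiLp.add_apply]
    rw [integral_add, integral_add, h1, h2]
    · ring
    · exact integrable_fun_mul (hu.memLp_gradient.eval_piLp i) (φ.memLp 2 _)
    · exact integrable_fun_mul (hv.memLp_gradient.eval_piLp i) (φ.memLp 2 _)
    · exact integrable_fun_mul hu.memLp (φ.memLp_fderiv _ 2 _)
    · exact integrable_fun_mul hv.memLp (φ.memLp_fderiv _ 2 _)

theorem isW12WithGradient_finsetSum {ι : Type*} (s : Finset ι) {u : ι → Eucl m → ℝ}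
    {G : ι → Eucl m → Eucl m} (h : ∀ i ∈ s, IsW12WithGradient D (u i) (G i)) :
    IsW12WithGradient D (fun x => ∑ i ∈ s, u i x) (fun x => ∑ i ∈ s, G i x) := by
  classical
  induction s using Finset.induction_on with
  | empty => exact ⟨by simp, by simp, by simp⟩
  | insert i s hi ih =>
    simp only [Finset.sum_insert hi]
    exact (h i (Finset.mem_insert_self i s)).add
      (ih fun j hj => h j (Finset.mem_insert_of_mem hj))

end ProductRule

/-! ### Reduction to real matrices, one coordinate at a time -/

section Coordinates

open Matrix

variable {m n : ℕ}

/-- The matrix of `a`-th coordinates of a matrix of vectors. -/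
def coordMatrix (A : Matrix (Fin n) (Fin n) (Eucl m)) (a : Fin m) : Matrix (Fin n) (Fin n) ℝ :=
  Matrix.of fun i j => A i j a

@[simp]
theorem coordMatrix_apply (A : Matrix (Fin n) (Fin n) (Eucl m)) (a : Fin m) (i j : Fin n) :
    coordMatrix A a i j = A i j a := rfl

theorem sum_norm_sq_eq_sum_trace (A : Matrix (Fin n) (Fin n) (Eucl m)) :
    ∑ i, ∑ j, ‖A i j‖ ^ 2 = ∑ a, trace ((coordMatrix A a)ᵀ * coordMatrix A a) := by
  simp only [EuclideanSpace.norm_sq_eq, trace, diag_apply, mul_apply, transpose_apply,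
    coordMatrix_apply, Real.norm_eq_abs, sq_abs]
  simp only [← sq]
  rw [Finset.sum_comm]
  exact (Finset.sum_congr rfl fun y _ => Finset.sum_comm).trans Finset.sum_comm

theorem coordMatrix_covGrad (P : Eucl m → Matrix (Fin n) (Fin n) ℝ)
    (dP Ω : Eucl m → Matrix (Fin n) (Fin n) (Eucl m)) (x : Eucl m) (a : Fin m) :
    coordMatrix (covGrad P dP Ω x) a = coordMatrix (dP x) a - coordMatrix (Ω x) a * P x := by
  ext i j
  simp [covGrad, mul_apply, mul_comm]

theorem coordMatrix_gaugeTransform (P : Eucl m → Matrix (Fin n) (Fin n) ℝ)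
    (dP Ω : Eucl m → Matrix (Fin n) (Fin n) (Eucl m)) (x : Eucl m) (a : Fin m) :
    coordMatrix (gaugeTransform P dP Ω x) a = (P x)ᵀ * coordMatrix (covGrad P dP Ω x) a := by
  ext i j
  simp only [coordMatrix_apply, gaugeTransform, mul_apply, transpose_apply, covGrad,
    PiLp.sub_apply, WithLp.ofLp_sum, Finset.sum_apply, PiLp.smul_apply, smul_eq_mul, mul_sub,
    Finset.sum_sub_distrib, Finset.mul_sum, mul_assoc]

/-- The gradient of `P R(φ)` for the rotations `R` generated by `α`. -/
noncomputable def rotateGradient (α : Matrix (Fin n) (Fin n) ℝ) (φ : Eucl m → ℝ)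
    (P : Eucl m → Matrix (Fin n) (Fin n) ℝ) (dP : Eucl m → Matrix (Fin n) (Fin n) (Eucl m)) :
    Eucl m → Matrix (Fin n) (Fin n) (Eucl m) :=
  fun x i j => ∑ l, (rodrigues α (φ x) l j • dP x i l +
    P x i l • ((rodrigues α (φ x) * α) l j • gradient φ x))

variable {α : Matrix (Fin n) (Fin n) ℝ}

theorem coordMatrix_rotateGradient (φ : Eucl m → ℝ) (P : Eucl m → Matrix (Fin n) (Fin n) ℝ)
    (dP : Eucl m → Matrix (Fin n) (Fin n) (Eucl m)) (x : Eucl m) (a : Fin m) :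
    coordMatrix (rotateGradient α φ P dP x) a = coordMatrix (dP x) a * rodrigues α (φ x) +
      gradient φ x a • (P x * (rodrigues α (φ x) * α)) := by
  ext i j
  rw [Matrix.add_apply, Matrix.smul_apply, mul_apply, mul_apply (M := P x)]
  simp only [coordMatrix_apply, rotateGradient, WithLp.ofLp_sum, Finset.sum_apply, PiLp.add_apply,
    PiLp.smul_apply, smul_eq_mul, Finset.mul_sum, ← Finset.sum_add_distrib]
  refine Finset.sum_congr rfl fun l _ => ?_
  ring

theorem skew_iff_coordMatrix (P : Matrix (Fin n) (Fin n) ℝ)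
    (A : Matrix (Fin n) (Fin n) (Eucl m)) :
    (∀ i j, ∑ k, (P k i • A k j + P k j • A k i) = 0) ↔
      ∀ a, Pᵀ * coordMatrix A a + (Pᵀ * coordMatrix A a)ᵀ = 0 := by
  have e : ∀ i j a, (∑ k, (P k i • A k j + P k j • A k i)) a =
      (Pᵀ * coordMatrix A a + (Pᵀ * coordMatrix A a)ᵀ) i j := by
    intro i j a
    simp [mul_apply, Finset.sum_add_distrib, mul_comm]
  constructor
  · intro h a
    ext i j
    rw [← e, h]; rfl
  · intro h i j
    ext a
    rw [e, h]; rfl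

end Coordinates

/-! ### Variation by rotations and the Coulomb condition -/

section EulerLagrange

open Matrix

variable {m n : ℕ} {D : Opens (Eucl m)} {P : Eucl m → Matrix (Fin n) (Fin n) ℝ}
  {dP Ω : Eucl m → Matrix (Fin n) (Fin n) (Eucl m)} {α : Matrix (Fin n) (Fin n) ℝ}

theorem trace_transpose_mul_self_mul_of_orthogonal (X : Matrix (Fin n) (Fin n) ℝ)
    {R : Matrix (Fin n) (Fin n) ℝ} (hR : Rᵀ * R = 1) :
    trace ((X * R)ᵀ * (X * R)) = trace (Xᵀ * X) := by
  have hR' : R * Rᵀ = 1 := mul_eq_one_comm.1 hR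
  rw [transpose_mul, mul_assoc, trace_mul_comm, mul_assoc, mul_assoc, hR', mul_one]

theorem trace_transpose_mul_self_of_orthogonal_mul (X : Matrix (Fin n) (Fin n) ℝ)
    {R : Matrix (Fin n) (Fin n) ℝ} (hR : R * Rᵀ = 1) :
    trace ((Rᵀ * X)ᵀ * (Rᵀ * X)) = trace (Xᵀ * X) := by
  rw [transpose_mul, transpose_transpose, mul_assoc, ← mul_assoc R, hR, one_mul]

/-- Because `α` commutes with `R(t)`, the rotation factors out on the right and drops from the norm.
The result is exactly quadratic in `g` and independent of `t`. -/
theorem trace_transpose_mul_self_rotate (hαT : αᵀ = -α) (hα : α * α * α = -α)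
    {Q : Matrix (Fin n) (Fin n) ℝ} (hQ : Qᵀ * Q = 1) (C : Matrix (Fin n) (Fin n) ℝ) (g t : ℝ) :
    trace ((C * rodrigues α t + g • (Q * (rodrigues α t * α)))ᵀ *
        (C * rodrigues α t + g • (Q * (rodrigues α t * α)))) =
      trace (Cᵀ * C) + 2 * g * trace ((Qᵀ * C)ᵀ * α) + g ^ 2 * trace (αᵀ * α) := by
  have e : C * rodrigues α t + g • (Q * (rodrigues α t * α)) =
      (C + g • (Q * α)) * rodrigues α t := by
    rw [← mul_rodrigues_comm, add_mul, smul_mul_assoc, mul_assoc]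
  rw [e, trace_transpose_mul_self_mul_of_orthogonal _ (rodrigues_transpose_mul_self hαT hα t)]
  have h1 : (Q * α)ᵀ * (Q * α) = αᵀ * α := by
    rw [transpose_mul, mul_assoc, ← mul_assoc Qᵀ, hQ, one_mul]
  have h2 : trace ((Q * α)ᵀ * C) = trace (Cᵀ * (Q * α)) := by
    rw [← trace_transpose, transpose_mul, transpose_transpose]
  have h3 : (Qᵀ * C)ᵀ * α = Cᵀ * (Q * α) := by
    rw [transpose_mul, transpose_transpose, mul_assoc]
  rw [h3]
  simp only [transpose_add, transpose_smul, add_mul, mul_add, smul_mul_assoc, mul_smul_comm,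
    trace_add, trace_smul, h1, h2, smul_eq_mul]
  ring

theorem gradient_rodrigues_apply (hα : α * α * α = -α) (φ : 𝓓(D, ℝ)) (l j : Fin n) (x : Eucl m) :
    gradient (fun x => rodrigues α (φ x) l j) x =
      (rodrigues α (φ x) * α) l j • gradient φ x := by
  ext a
  have h := (hasDerivAt_rodrigues_apply hα l j (φ x)).comp_hasFDerivAt x
    (φ.contDiff.differentiable (by simp)).differentiableAt.hasFDerivAt
  rw [PiLp.smul_apply, gradient_apply_eq_fderiv, gradient_apply_eq_fderiv]
  change fderiv ℝ ((fun t => rodrigues α t l j) ∘ φ) x _ = _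
  rw [h.fderiv]
  simp

/-- Admissibility of the variation: with `R = R(φ)` one has `(PR)ᵀ∇(PR) = Rᵀ(Pᵀ∇P)R + ∇φ α`, a sum
of skew terms. -/
theorem IsSkewFrame.rotate (h : IsSkewFrame D P dP) (hαT : αᵀ = -α) (hα : α * α * α = -α)
    (φ : 𝓓(D, ℝ)) :
    IsSkewFrame D (fun x => P x * rodrigues α (φ x)) (rotateGradient α φ P dP) where
  entry i j := by
    have hl : ∀ l ∈ Finset.univ, IsW12WithGradient D (fun x => P x i l * rodrigues α (φ x) l j)
        (fun x => rodrigues α (φ x) l j • dP x i l +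
          P x i l • ((rodrigues α (φ x) * α) l j • gradient φ x)) := by
      intro l _
      obtain ⟨C, hC⟩ := φ.exists_norm_gradient_le
      have := (h.entry i l).mul_smooth (η := fun x => rodrigues α (φ x) l j)
        ((contDiff_rodrigues_apply l j).comp φ.contDiff) (C := 1)
        (C' := (|α l j| + |(α * α) l j|) * C)
        (fun x => abs_apply_le_one_of_mem_specialOrthogonalGroup
          (rodrigues_mem_specialOrthogonalGroup hαT hα (φ x)) l j) (fun x => ?_)
      · simpa only [gradient_rodrigues_apply hα] using this
      · rw [gradient_rodrigues_apply hα, norm_smul]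
        refine mul_le_mul ?_ (hC x) (norm_nonneg _) (by positivity)
        rw [rodrigues_mul hα, Matrix.add_apply, Matrix.smul_apply, Matrix.smul_apply,
          Real.norm_eq_abs]
        refine (abs_add_le _ _).trans (add_le_add ?_ ?_) <;> rw [smul_eq_mul, abs_mul]
        · exact mul_le_of_le_one_left (abs_nonneg _) (Real.abs_cos_le_one _)
        · exact mul_le_of_le_one_left (abs_nonneg _) (Real.abs_sin_le_one _)
    exact isW12WithGradient_finsetSum Finset.univ hl
  mem_SO := by
    filter_upwards [h.mem_SO] with x hx
    exact mul_mem hx (rodrigues_mem_specialOrthogonalGroup hαT hα (φ x))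
  skew := by
    filter_upwards [h.mem_SO, h.skew] with x hx hs
    have hP : (P x)ᵀ * P x = 1 := (mem_specialOrthogonalGroup_iff_transpose_mul.1 hx).1
    rw [skew_iff_coordMatrix] at hs ⊢
    intro a
    have hsa := hs a
    set R := rodrigues α (φ x)
    have hR : Rᵀ * R = 1 := rodrigues_transpose_mul_self hαT hα (φ x)
    set S := (P x)ᵀ * coordMatrix (dP x) a with hS
    have e : (P x * R)ᵀ * coordMatrix (rotateGradient α φ P dP x) a =
        Rᵀ * S * R + gradient φ x a • α := by
      rw [coordMatrix_rotateGradient, mul_add, mul_smul_comm, transpose_mul]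
      congr 1
      · simp only [hS, mul_assoc]; rfl
      · congr 1
        rw [mul_assoc, ← mul_assoc _ (P x), hP, one_mul, ← mul_assoc, hR, one_mul]
    rw [e]
    have e2 : Rᵀ * S * R + gradient φ x a • α + (Rᵀ * S * R + gradient φ x a • α)ᵀ =
        Rᵀ * (S + Sᵀ) * R := by
      simp only [transpose_add, transpose_smul, transpose_mul, transpose_transpose, hαT, mul_add,
        add_mul, mul_assoc]
      module
    rw [e2, hsa, mul_zero, zero_mul]

theorem sum_norm_sq_covGrad_rotate (hαT : αᵀ = -α) (hα : α * α * α = -α) (φ : Eucl m → ℝ)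
    {x : Eucl m} (hx : (P x)ᵀ * P x = 1) :
    ∑ i, ∑ j, ‖covGrad (fun x => P x * rodrigues α (φ x)) (rotateGradient α φ P dP) Ω x i j‖ ^ 2 =
      ∑ i, ∑ j, ‖covGrad P dP Ω x i j‖ ^ 2 +
        2 * ∑ a, gradient φ x a * trace ((coordMatrix (gaugeTransform P dP Ω x) a)ᵀ * α) +
        trace (αᵀ * α) * ‖gradient φ x‖ ^ 2 := by
  rw [sum_norm_sq_eq_sum_trace, sum_norm_sq_eq_sum_trace, EuclideanSpace.norm_sq_eq,
    Finset.mul_sum, Finset.mul_sum, ← Finset.sum_add_distrib, ← Finset.sum_add_distrib]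
  refine Finset.sum_congr rfl fun a _ => ?_
  have e : coordMatrix (covGrad (fun x => P x * rodrigues α (φ x)) (rotateGradient α φ P dP) Ω x) a =
      coordMatrix (covGrad P dP Ω x) a * rodrigues α (φ x) +
        gradient φ x a • (P x * (rodrigues α (φ x) * α)) := by
    rw [coordMatrix_covGrad, coordMatrix_covGrad, coordMatrix_rotateGradient, sub_mul, mul_assoc]
    abel
  rw [e, trace_transpose_mul_self_rotate hαT hα hx, coordMatrix_gaugeTransform, Real.norm_eq_abs,
    sq_abs]
  ring

/-- Here the skew constraint on the class enters: `Pᵀ∇P` is skew by membership and `PᵀΩP` because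
`Ω` is. -/
theorem IsSkewFrame.gaugeTransform_skew (h : IsSkewFrame D P dP)
    (hΩ_skew : ∀ i j, ∀ᵐ x ∂(volume.restrict (D : Set (Eucl m))), Ω x i j = -Ω x j i) :
    ∀ᵐ x ∂(volume.restrict (D : Set (Eucl m))), ∀ i j,
      gaugeTransform P dP Ω x i j = -gaugeTransform P dP Ω x j i := by
  have hΩ' : ∀ᵐ x ∂(volume.restrict (D : Set (Eucl m))), ∀ i j, Ω x i j = -Ω x j i :=
    ae_all_iff.2 fun i => ae_all_iff.2 fun j => hΩ_skew i j
  filter_upwards [hΩ', h.skew] with x hx hs i j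
  rw [skew_iff_coordMatrix] at hs
  ext a
  have hΩa : (coordMatrix (Ω x) a)ᵀ = -coordMatrix (Ω x) a := by
    ext i j
    simp [hx j i]
  have e : coordMatrix (gaugeTransform P dP Ω x) a +
      (coordMatrix (gaugeTransform P dP Ω x) a)ᵀ = 0 := by
    rw [coordMatrix_gaugeTransform, coordMatrix_covGrad, mul_sub, transpose_sub]
    have h1 : ((P x)ᵀ * (coordMatrix (Ω x) a * P x))ᵀ =
        -((P x)ᵀ * (coordMatrix (Ω x) a * P x)) := by
      simp only [transpose_mul, transpose_transpose, hΩa, mul_assoc, neg_mul, mul_neg]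
    rw [h1, ← hs a]
    abel
  have := congrFun (congrFun e i) j
  simp only [Matrix.add_apply, transpose_apply, coordMatrix_apply, Matrix.zero_apply] at this
  rw [PiLp.neg_apply]
  linarith

theorem gaugeTransform_eq_sum (x : Eucl m) (i j : Fin n) :
    gaugeTransform P dP Ω x i j = ∑ k, P x k i • covGrad P dP Ω x k j := by
  ext a
  have := congrFun (congrFun (coordMatrix_gaugeTransform P dP Ω x a) i) j
  simpa [mul_apply] using this

theorem memLp_gaugeTransform (h : IsW12SOWithGradient D P dP)
    (hΩ : ∀ i j, MemLp (fun x => Ω x i j) 2 (volume.restrict (D : Set (Eucl m)))) (i j : Fin n) :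
    MemLp (fun x => gaugeTransform P dP Ω x i j) 2 (volume.restrict (D : Set (Eucl m))) := by
  simp_rw [gaugeTransform_eq_sum]
  exact memLp_finsetSum _ fun k _ => (memLp_covGrad h hΩ k j).smul (h.memLp_top k i) (r := 2)

theorem gaugeEnergy_eq_integral (h : IsW12SOWithGradient D P dP)
    (hΩ : ∀ i j, MemLp (fun x => Ω x i j) 2 (volume.restrict (D : Set (Eucl m)))) :
    gaugeEnergy D P dP Ω =
      ∫ x in (D : Set (Eucl m)), ∑ i, ∑ j, ‖covGrad P dP Ω x i j‖ ^ 2 := by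
  have hi : ∀ i j, Integrable (fun x => ‖covGrad P dP Ω x i j‖ ^ 2)
      (volume.restrict (D : Set (Eucl m))) := fun i j =>
    (memLp_covGrad h hΩ i j).integrable_norm_pow (by simp)
  rw [integral_finsetSum _ fun i _ => integrable_finsetSum _ fun j _ => hi i j, gaugeEnergy]
  exact Finset.sum_congr rfl fun i _ => (integral_finsetSum _ fun j _ => hi i j).symm

/-- The factor `4` combines the `2` of the cross term with the trace pairing `(Ω^P)_ij - (Ω^P)_ji =
2 (Ω^P)_ij`. -/
theorem gaugeEnergy_rotate (h : IsSkewFrame D P dP)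
    (hΩ : ∀ i j, MemLp (fun x => Ω x i j) 2 (volume.restrict (D : Set (Eucl m))))
    (hΩ_skew : ∀ i j, ∀ᵐ x ∂(volume.restrict (D : Set (Eucl m))), Ω x i j = -Ω x j i)
    {i j : Fin n} (hij : i ≠ j) (φ : 𝓓(D, ℝ)) :
    gaugeEnergy D (fun x => P x * rodrigues (skewSingle i j) (φ x))
        (rotateGradient (skewSingle i j) φ P dP) Ω =
      gaugeEnergy D P dP Ω +
        4 * (∫ x in (D : Set (Eucl m)), inner ℝ (gaugeTransform P dP Ω x i j) (gradient φ x)) +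
        trace ((skewSingle i j)ᵀ * skewSingle i j) *
          ∫ x in (D : Set (Eucl m)), ‖gradient φ x‖ ^ 2 := by
  have hαT := skewSingle_transpose i j
  have hα := skewSingle_pow_three hij
  have hφ : MemLp (gradient φ) 2 (volume.restrict (D : Set (Eucl m))) :=
    MemLp.of_eval_piLp fun a => by
      simpa only [gradient_apply_eq_fderiv] using φ.memLp_fderiv (EuclideanSpace.single a 1) 2 _
  have h1 : Integrable (fun x => ∑ i, ∑ j, ‖covGrad P dP Ω x i j‖ ^ 2)
      (volume.restrict (D : Set (Eucl m))) :=
    integrable_finsetSum _ fun i _ => integrable_finsetSum _ fun j _ =>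
      (memLp_covGrad h.toIsW12SOWithGradient hΩ i j).integrable_norm_pow (by simp)
  have h2 := integrable_inner_of_memLp (memLp_gaugeTransform h.toIsW12SOWithGradient hΩ i j) hφ
  have h3 : Integrable (fun x => ‖gradient φ x‖ ^ 2) (volume.restrict (D : Set (Eucl m))) :=
    hφ.integrable_norm_pow (by simp)
  have h12 : Integrable (fun x => ∑ i, ∑ j, ‖covGrad P dP Ω x i j‖ ^ 2 +
      4 * inner ℝ (gaugeTransform P dP Ω x i j) (gradient φ x))
      (volume.restrict (D : Set (Eucl m))) := h1.add (h2.const_mul 4)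
  rw [gaugeEnergy_eq_integral (h.rotate hαT hα φ).toIsW12SOWithGradient hΩ,
    gaugeEnergy_eq_integral h.toIsW12SOWithGradient hΩ, ← integral_const_mul, ← integral_const_mul,
    ← integral_add h1 (h2.const_mul 4), ← integral_add h12 (h3.const_mul _)]
  refine integral_congr_ae ?_
  filter_upwards [h.mem_SO, h.gaugeTransform_skew hΩ_skew] with x hx hs
  rw [sum_norm_sq_covGrad_rotate hαT hα φ (mem_specialOrthogonalGroup_iff_transpose_mul.1 hx).1]
  congr 2
  rw [PiLp.inner_apply, Finset.mul_sum, Finset.mul_sum]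
  refine Finset.sum_congr rfl fun a _ => ?_
  rw [trace_transpose_mul_skewSingle, coordMatrix_apply, coordMatrix_apply, hs j i]
  simp
  ring

/-- The Euler-Lagrange equation of the gauge energy: minimisers are Coulomb gauges. -/
theorem isWeaklyDivFree_gaugeTransform (hD : Bornology.IsBounded (D : Set (Eucl m)))
    (h : IsSkewFrame D P dP)
    (hΩ : ∀ i j, MemLp (fun x => Ω x i j) 2 (volume.restrict (D : Set (Eucl m))))
    (hΩ_skew : ∀ i j, ∀ᵐ x ∂(volume.restrict (D : Set (Eucl m))), Ω x i j = -Ω x j i)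
    (hmin : ∀ P' dP', IsSkewFrame D P' dP' → gaugeEnergy D P dP Ω ≤ gaugeEnergy D P' dP' Ω)
    (i j : Fin n) : IsWeaklyDivFree D (fun x => gaugeTransform P dP Ω x i j) where
  locallyIntegrableOn := by
    have := isFiniteMeasure_restrict_of_isBounded hD
    have hint : IntegrableOn (fun x => gaugeTransform P dP Ω x i j) (D : Set (Eucl m)) :=
      (memLp_gaugeTransform h.toIsW12SOWithGradient hΩ i j).integrable (by norm_num)
    exact hint.locallyIntegrableOn
  integral_eq_zero φ := by
    by_cases hij : i = j
    · subst hij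
      rw [← integral_zero (Eucl m) ℝ (μ := volume.restrict (D : Set (Eucl m)))]
      refine integral_congr_ae ?_
      filter_upwards [h.gaugeTransform_skew hΩ_skew] with x hx
      have h0 : gaugeTransform P dP Ω x i i = 0 := by
        ext a
        have := congrArg (fun v : Eucl m => v a) (hx i i)
        simp only [PiLp.neg_apply] at this
        rw [PiLp.zero_apply]
        linarith
      rw [h0, inner_zero_left]
    set b := ∫ x in (D : Set (Eucl m)), inner ℝ (gaugeTransform P dP Ω x i j) (gradient φ x) with hb
    set c := trace ((skewSingle i j)ᵀ * skewSingle i j) *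
      ∫ x in (D : Set (Eucl m)), ‖gradient φ x‖ ^ 2 with hc
    have hgrad : ∀ (ε : ℝ) x, gradient (ε • φ : 𝓓(D, ℝ)) x = ε • gradient φ x := by
      intro ε x
      ext a
      rw [PiLp.smul_apply, gradient_apply_eq_fderiv, gradient_apply_eq_fderiv]
      change fderiv ℝ (ε • ⇑φ) x _ = _
      rw [fderiv_const_smul (φ.contDiff.differentiable (by simp)).differentiableAt]
      rfl
    -- Apply the expansion to `εφ`: minimality makes a quadratic without constant term non-negative,
    -- so its discriminant `(4b)²` is at most zero.
    have hε : ∀ ε : ℝ, 0 ≤ c * (ε * ε) + 4 * b * ε + 0 := by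
      intro ε
      have h1 := gaugeEnergy_rotate h hΩ hΩ_skew hij (ε • φ)
      have h2 := hmin _ _ (h.rotate (skewSingle_transpose i j) (skewSingle_pow_three hij) (ε • φ))
      simp only [hgrad, inner_smul_right, norm_smul, mul_pow, integral_const_mul, ← hb,
        Real.norm_eq_abs, sq_abs] at h1
      rw [h1] at h2
      have : trace ((skewSingle i j)ᵀ * skewSingle i j) *
          (ε ^ 2 * ∫ x in (D : Set (Eucl m)), ‖gradient φ x‖ ^ 2) = ε ^ 2 * c := by
        rw [hc]; ring
      rw [this] at h2
      linarith
    have := discrim_le_zero hε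
    rw [discrim] at this
    nlinarith [sq_nonneg b]

end EulerLagrange

/-! ### Norm estimates -/

section Bounds

open Matrix

variable {m n : ℕ} {D : Opens (Eucl m)} {P : Eucl m → Matrix (Fin n) (Fin n) ℝ}
  {dP Ω A B : Eucl m → Matrix (Fin n) (Fin n) (Eucl m)}

theorem hsNorm_eq_norm_toLp (A : Matrix (Fin n) (Fin n) (Eucl m)) :
    hsNorm A = ‖(WithLp.toLp 2 fun p : Fin n × Fin n => A p.1 p.2 :
      PiLp 2 fun _ : Fin n × Fin n => Eucl m)‖ := by
  rw [PiLp.norm_eq_of_L2, hsNorm, Fintype.sum_prod_type]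

theorem hsNorm_add_le (A B : Matrix (Fin n) (Fin n) (Eucl m)) :
    hsNorm (A + B) ≤ hsNorm A + hsNorm B := by
  simp only [hsNorm_eq_norm_toLp]
  exact norm_add_le (WithLp.toLp 2 fun p : Fin n × Fin n => A p.1 p.2 :
    PiLp 2 fun _ : Fin n × Fin n => Eucl m) (WithLp.toLp 2 fun p : Fin n × Fin n => B p.1 p.2)

theorem hsNorm_nonneg (A : Matrix (Fin n) (Fin n) (Eucl m)) : 0 ≤ hsNorm A := Real.sqrt_nonneg _

theorem hsNorm_sq (A : Matrix (Fin n) (Fin n) (Eucl m)) : hsNorm A ^ 2 = ∑ i, ∑ j, ‖A i j‖ ^ 2 :=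
  Real.sq_sqrt (Finset.sum_nonneg fun _ _ => Finset.sum_nonneg fun _ _ => by positivity)

theorem memLp_hsNorm {μ : Measure (Eucl m)} (hA : ∀ i j, MemLp (fun x => A x i j) 2 μ) :
    MemLp (fun x => hsNorm (A x)) 2 μ := by
  simp_rw [hsNorm_eq_norm_toLp]
  exact (MemLp.of_eval_piLp (f := fun x => (WithLp.toLp 2 fun p : Fin n × Fin n => A x p.1 p.2 :
    PiLp 2 fun _ : Fin n × Fin n => Eucl m)) fun p => hA p.1 p.2).norm

theorem l2Norm_eq_ofReal_sqrt
    (hA : ∀ i j, MemLp (fun x => A x i j) 2 (volume.restrict (D : Set (Eucl m)))) :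
    l2Norm D A =
      ENNReal.ofReal (√(∑ i, ∑ j, ∫ x in (D : Set (Eucl m)), ‖A x i j‖ ^ 2)) := by
  have h := memLp_hsNorm hA
  have hi : ∀ i j, Integrable (fun x => ‖A x i j‖ ^ 2) (volume.restrict (D : Set (Eucl m))) :=
    fun i j => (hA i j).integrable_norm_pow (by simp)
  have e : ∫ x in (D : Set (Eucl m)), hsNorm (A x) ^ 2 =
      ∑ i, ∑ j, ∫ x in (D : Set (Eucl m)), ‖A x i j‖ ^ 2 := by
    simp_rw [hsNorm_sq]
    rw [integral_finsetSum _ fun i _ => integrable_finsetSum _ fun j _ => hi i j]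
    exact Finset.sum_congr rfl fun i _ => integral_finsetSum _ fun j _ => hi i j
  rw [← e, ← norm_toLp_eq_sqrt h, Lp.norm_toLp, l2Norm, ENNReal.ofReal_toReal h.eLpNorm_ne_top]

theorem hsNorm_gaugeTransform {x : Eucl m} (hx : (P x)ᵀ * P x = 1) :
    hsNorm (gaugeTransform P dP Ω x) = hsNorm (covGrad P dP Ω x) := by
  rw [hsNorm, hsNorm, sum_norm_sq_eq_sum_trace, sum_norm_sq_eq_sum_trace]
  simp_rw [coordMatrix_gaugeTransform,
    trace_transpose_mul_self_of_orthogonal_mul _ (mul_eq_one_comm.1 hx)]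

theorem hsNorm_sum_smul {A : Matrix (Fin n) (Fin n) (Eucl m)} {Q : Matrix (Fin n) (Fin n) ℝ}
    (hQ : Qᵀ * Q = 1) : hsNorm (Matrix.of fun i j => ∑ l, Q l j • A i l) = hsNorm A := by
  have e : ∀ a, coordMatrix (Matrix.of fun i j => ∑ l, Q l j • A i l) a = coordMatrix A a * Q := by
    intro a
    ext i j
    simp [mul_apply, mul_comm]
  rw [hsNorm, hsNorm, sum_norm_sq_eq_sum_trace, sum_norm_sq_eq_sum_trace]
  simp_rw [e, trace_transpose_mul_self_mul_of_orthogonal _ hQ]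

theorem l2Norm_gaugeTransform (h : IsW12SOWithGradient D P dP) :
    l2Norm D (gaugeTransform P dP Ω) = l2Norm D (covGrad P dP Ω) := by
  refine eLpNorm_congr_ae ?_
  filter_upwards [h.mem_SO] with x hx
  exact hsNorm_gaugeTransform (mem_specialOrthogonalGroup_iff_transpose_mul.1 hx).1

/-- The triangle inequality for `∇P = (∇P - ΩP) + ΩP`, where right multiplication by the orthogonal
`P` preserves the Hilbert-Schmidt norm of `Ω`, so no dimensional constant appears. -/
theorem l2Norm_gradient_le (h : IsW12SOWithGradient D P dP)
    (hΩ : ∀ i j, MemLp (fun x => Ω x i j) 2 (volume.restrict (D : Set (Eucl m)))) :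
    l2Norm D dP ≤ l2Norm D (covGrad P dP Ω) + l2Norm D Ω := by
  refine (eLpNorm_mono_ae_real (g := fun x => hsNorm (covGrad P dP Ω x) + hsNorm (Ω x)) ?_).trans
    (eLpNorm_add_le (memLp_hsNorm (memLp_covGrad h hΩ)).aestronglyMeasurable
      (memLp_hsNorm hΩ).aestronglyMeasurable (by norm_num))
  filter_upwards [h.mem_SO] with x hx
  rw [Real.norm_of_nonneg (hsNorm_nonneg _),
    ← hsNorm_sum_smul (A := Ω x) (mem_specialOrthogonalGroup_iff_transpose_mul.1 hx).1]
  refine le_trans (le_of_eq ?_) (hsNorm_add_le _ _)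
  congr 1
  ext1 i j
  rw [Matrix.add_apply]
  simp [covGrad]

theorem l2Norm_covGrad_le_of_minimizer (hD : Bornology.IsBounded (D : Set (Eucl m)))
    (h : IsSkewFrame D P dP)
    (hΩ : ∀ i j, MemLp (fun x => Ω x i j) 2 (volume.restrict (D : Set (Eucl m))))
    (hmin : ∀ P' dP', IsSkewFrame D P' dP' → gaugeEnergy D P dP Ω ≤ gaugeEnergy D P' dP' Ω) :
    l2Norm D (covGrad P dP Ω) ≤ l2Norm D Ω := by
  rw [l2Norm_eq_ofReal_sqrt (memLp_covGrad h.toIsW12SOWithGradient hΩ), l2Norm_eq_ofReal_sqrt hΩ]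
  refine ENNReal.ofReal_le_ofReal (Real.sqrt_le_sqrt ((hmin _ _ (isSkewFrame_one hD)).trans_eq ?_))
  -- For the frame `1` the covariant gradient is `-Ω`.
  simp [gaugeEnergy, covGrad, Matrix.one_apply]

end Bounds

/-! ### Existence of the Coulomb gauge -/

theorem theorem2p1 {m n : ℕ} (D : Opens (Eucl m)) (hD : IsSmoothlyBoundedDomain D)
    (Ω : Eucl m → Matrix (Fin n) (Fin n) (Eucl m))
    (hΩ : ∀ i j, MemLp (fun x => Ω x i j) 2 (volume.restrict (D : Set (Eucl m))))
    (hΩ_skew : ∀ i j, ∀ᵐ x ∂(volume.restrict (D : Set (Eucl m))), Ω x i j = -Ω x j i) :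
    ∃ (P : Eucl m → Matrix (Fin n) (Fin n) ℝ)
      (dP : Eucl m → Matrix (Fin n) (Fin n) (Eucl m)),
      IsW12SOWithGradient D P dP ∧
      (∀ i j, IsWeaklyDivFree D (fun x => gaugeTransform P dP Ω x i j)) ∧
      l2Norm D dP + l2Norm D (gaugeTransform P dP Ω) ≤ 3 * l2Norm D Ω := by
  obtain ⟨P, dP, hP, hmin⟩ := exists_isSkewFrame_forall_gaugeEnergy_le hD.isBounded hΩ
  refine ⟨P, dP, hP.toIsW12SOWithGradient,
    isWeaklyDivFree_gaugeTransform hD.isBounded hP hΩ hΩ_skew hmin, ?_⟩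
  have h1 := l2Norm_covGrad_le_of_minimizer hD.isBounded hP hΩ hmin
  rw [l2Norm_gaugeTransform hP.toIsW12SOWithGradient]
  calc l2Norm D dP + l2Norm D (covGrad P dP Ω)
      ≤ l2Norm D Ω + l2Norm D Ω + l2Norm D Ω := by
        gcongr
        exact (l2Norm_gradient_le hP.toIsW12SOWithGradient hΩ).trans (by gcongr)
    _ = 3 * l2Norm D Ω := by ring
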